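/- Let $\mathcal X\subseteq\mathbb R^n$ be open and consider the input-affine system $\dot x=f(x)+g(x)u$, $x\in\mathcal X$, $u\in\mathbb R^m$, where $f:\mathcal X\to\mathbb R^n$ and $g:\mathcal X\to\mathbb R^{n\times m}$ are locally Lipschitz and $\operatorname{rank} g(x)=m$ for all $x\in\mathcal X$. Let $g^\perp(x)\in\mathbb R^{(n-m)\times n}$ be a left annihilator of $g(x)$ of full rank $n-m$, and let $x_*\in\mathcal X$ be an assignable equilibrium, i.e. $g^\perp(x_*)f(x_*)=0$. A subscript $*$ denotes evaluation at $x_*$; $\nabla\gamma$ is the matrix whose $i$-th column is $\nabla\gamma_i$. Put $\kappa:=(g_*^\top g_*)^{-1}g_*^\top f_*$. Assumption 1. There are a $C^2$ function $S:\mathcal X\to\mathbb R$ and a map $\ell:\mathcal X\to\mathbb R^r$ with $\nabla S(x)^\top f(x)=-\|\ell(x)\|^2$ on $\mathcal X$. Given maps $w:\mathcal X\to\mathbb R^{r\times m}$ and $D:\mathcal X\to\mathbb R^{m\times m}$ with $D(x)=-D(x)^\top$, let $$y=g^\top(x)\nabla S(x)+2w^\top(x)\ell(x)+[w^\top(x)w(x)+D(x)]u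 .$$ Assumption 2. There are constants $\alpha_i,\beta_i>0$ ($i=1,\dots,m$) and a $C^2$ map $\gamma:\mathcal X\to\mathbb R^m$ such that $\dot\gamma=y$, i.e. $(\nabla\gamma(x))^\top(f(x)+g(x)u)=y(x,u)$ for all $x\in\mathcal X$, $u\in\mathbb R^m$; $(\nabla S)_*+(\nabla\gamma)_*\kappa=0$; and the matrix $(\nabla^2S)_*+\sum_{i=1}^m\alpha_i\beta_i(\nabla\gamma_i)_*(\nabla\gamma_i)_*^\top+(\nabla^2(\gamma^\top\kappa))_*$ is positive definite. Let $k_{p_1},\dots,k_{p_m}>0$, let $\Phi(\gamma)=\sum_{i=1}^m\frac{\alpha_i}{\beta_i}\ln\cosh(\beta_i(\gamma_i-\gamma_{i*}))$ with $\gamma_{i*}=\gamma_i(x_*)$, and consider the control law $$u=-\nabla_\gamma\Phi(\gamma(x))-\kappa-\sum_{i=1}^m e_i\,k_{p_i}\tanh(y_i),$$ which, since $y$ may depend on $u$, is an equation for $u$. For every $x\in\mathcal X$ it has exactly one solution $u=u(x)$, and for the resulting feedback and closed-loop system: (i) for all $x\in\mathcal X$ and all $i$, $u_i\in[-\kappa_i-k_{p_i}-\alpha_i,\,-\kappa_i+k_{p_i}+\alpha_i]$;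 (ii) $x_*$ is a (locally) stable equilibrium of the closed-loop system, with Lyapunov function $S_d(x)=S(x)+\Phi(\gamma(x))+\kappa^\top\gamma(x)$: on a neighbourhood of $x_*$, $S_d$ is $C^1$, $S_d(x)>S_d(x_*)$ for $x\neq x_*$, and $\dot S_d\le0$ along the closed-loop vector field; (iii) $x_*$ is locally asymptotically stable if there is an open set $\Omega\subseteq\mathcal X$ containing $x_*$ such that, for all $x\in\Omega$, the two equalities $\ell(x)=w(x)\big(\nabla_\gamma\Phi(\gamma(x))+\kappa\big)$ and $y(x,u(x))=0$ together imply $x=x_*$. Stability means: for every $\varepsilon>0$ there is $\delta>0$ such that from every initial state in $\mathcal X$ within distance $\delta$ of $x_*$ there is a solution in $\mathcal X$ on $[0,\infty)$, and every solution from it stays within distance $\varepsilon$ of $x_*$. Local asymptotic stability means stability together with convergence to $x_*$ of all solutions on $[0,\infty)$ starting sufficiently close to $x_*$. -/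

import Mathlib

open Matrix Topology

noncomputable section

namespace SaturatedPBC

/-- Real coordinate space of dimension `k` with the Euclidean norm. -/
abbrev Vec (k : ℕ) : Type := EuclideanSpace ℝ (Fin k)

/-- The Hessian matrix `(∂²φ / ∂xᵢ ∂xⱼ)`. -/
def hessian {n : ℕ} (φ : Vec n → ℝ) (x : Vec n) : Matrix (Fin n) (Fin n) ℝ :=
  Matrix.of fun i j => fderiv ℝ (gradient φ) x (EuclideanSpace.single j 1) i

/-- The `n × m` matrix whose `j`-th column is the gradient of the `j`-th component of `F`. -/
def jacobian {n m : ℕ} (F : Vec n → Vec m) (x : Vec n) : Matrix (Fin n) (Fin m) ℝ :=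
  Matrix.of fun i j => gradient (fun z => F z j) x i

/-! ### Autonomous differential equations and stability -/

/-- `c` is a solution of `ẋ = F x` on the time set `J` that stays in the state space `X`. -/
def IsSolution {n : ℕ} (X : Set (Vec n)) (F : Vec n → Vec n) (J : Set ℝ) (c : ℝ → Vec n) : Prop :=
  Set.MapsTo c J X ∧ IsIntegralCurveOn c (fun _ => F) J

/-- `xs` is a (Lyapunov) stable equilibrium of `ẋ = F x` on `X`: the solutions that start close
to `xs` exist for all future times and stay close to `xs`. -/
def IsStableEquilibrium {n : ℕ} (X : Set (Vec n)) (F : Vec n → Vec n) (xs : Vec n) : Prop :=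
  xs ∈ X ∧ F xs = 0 ∧
    ∀ ε > 0, ∃ δ > 0, ∀ x₀ ∈ X, dist x₀ xs < δ →
      (∃ c, c 0 = x₀ ∧ IsSolution X F (Set.Ici 0) c) ∧
      ∀ (T : ℝ) (c : ℝ → Vec n), c 0 = x₀ → IsSolution X F (Set.Icc 0 T) c →
        ∀ t ∈ Set.Icc 0 T, dist (c t) xs < ε

/-- `xs` is a locally asymptotically stable equilibrium: it is stable, and every solution that
starts close enough to `xs` converges to `xs`. -/
def IsAsymptoticallyStableEquilibrium {n : ℕ} (X : Set (Vec n)) (F : Vec n → Vec n)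
    (xs : Vec n) : Prop :=
  IsStableEquilibrium X F xs ∧
    ∃ δ > 0, ∀ c : ℝ → Vec n, dist (c 0) xs < δ → IsSolution X F (Set.Ici 0) c →
      Filter.Tendsto c Filter.atTop (𝓝 xs)

/-- `V` is a Lyapunov function for `ẋ = F x` at `xs`: near `xs` it is continuously
differentiable, `V - V xs` is positive definite, and `V` does not increase along the flow. -/
def IsLyapunovFunction {n : ℕ} (X : Set (Vec n)) (F : Vec n → Vec n) (xs : Vec n)
    (V : Vec n → ℝ) : Prop :=
  ∃ U ⊆ X, IsOpen U ∧ xs ∈ U ∧ ContDiffOn ℝ 1 V U ∧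
    (∀ x ∈ U, x ≠ xs → V xs < V x) ∧
    ∀ x ∈ U, inner ℝ (gradient V x) (F x) ≤ 0

/-! ### Input-affine systems -/

/-- The system `ẋ = f x + g x u` with state space an open set `X ⊆ ℝⁿ` and input `u ∈ ℝᵐ`. -/
structure InputAffineSystem (n m : ℕ) where
  X : Set (Vec n)
  f : Vec n → Vec n
  g : Vec n → Matrix (Fin n) (Fin m) ℝ
  isOpen_X : IsOpen X
  lipschitz_f : LocallyLipschitzOn X f
  lipschitz_g : ∀ i j, LocallyLipschitzOn X fun x => g x i j
  rank_g : ∀ x ∈ X, (g x).rank = m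

namespace InputAffineSystem

variable {n m r : ℕ} (P : InputAffineSystem n m)

/-- The velocity `f x + g x u`. -/
def velocity (x : Vec n) (u : Vec m) : Vec n :=
  P.f x + (P.g x).toEuclideanLin u

/-- `N` is a left annihilator of `g`, of full rank `n - m`. -/
def IsLeftAnnihilator (N : Vec n → Matrix (Fin (n - m)) (Fin n) ℝ) : Prop :=
  ∀ x ∈ P.X, N x * P.g x = 0 ∧ (N x).rank = n - m

/-- The set of assignable equilibria, for a left annihilator `N` of `g`. -/
def assignableEquilibria (N : Vec n → Matrix (Fin (n - m)) (Fin n) ℝ) : Set (Vec n) :=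
  {x | x ∈ P.X ∧ (N x).toEuclideanLin (P.f x) = 0}

/-- `∇S(x)ᵀ f(x) = -‖ℓ(x)‖²` on the state space. -/
def IsStorage (S : Vec n → ℝ) (l : Vec n → Vec r) : Prop :=
  ContDiffOn ℝ 2 S P.X ∧ ∀ x ∈ P.X, inner ℝ (gradient S x) (P.f x) = -‖l x‖ ^ 2

/-- The passive output `y = gᵀ∇S + 2wᵀℓ + (wᵀw + D)u` as a function of state and input. -/
def output (S : Vec n → ℝ) (l : Vec n → Vec r) (w : Vec n → Matrix (Fin r) (Fin m) ℝ)
    (D : Vec n → Matrix (Fin m) (Fin m) ℝ) (x : Vec n) (u : Vec m) : Vec m :=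
  (P.g x)ᵀ.toEuclideanLin (gradient S x) + (2 : ℝ) • (w x)ᵀ.toEuclideanLin (l x)
    + ((w x)ᵀ * w x + D x).toEuclideanLin u

/-- `κ = (g⋆ᵀ g⋆)⁻¹ g⋆ᵀ f⋆`, evaluated at `xs`. -/
def kappa (xs : Vec n) : Vec m :=
  (((P.g xs)ᵀ * P.g xs)⁻¹ * (P.g xs)ᵀ).toEuclideanLin (P.f xs)

/-- The map `γ` satisfies `γ̇ = y` (for every state and every input), and with the weights
`α`, `β` it satisfies the first- and second-order conditions at `xs`. -/
def IsShaping (S : Vec n → ℝ) (l : Vec n → Vec r) (w : Vec n → Matrix (Fin r) (Fin m) ℝ)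
    (D : Vec n → Matrix (Fin m) (Fin m) ℝ) (xs : Vec n) (α β : Fin m → ℝ)
    (γ : Vec n → Vec m) : Prop :=
  ContDiffOn ℝ 2 γ P.X ∧
  (∀ x ∈ P.X, ∀ u : Vec m, fderiv ℝ γ x (P.velocity x u) = P.output S l w D x u) ∧
  gradient S xs + (jacobian γ xs).toEuclideanLin (P.kappa xs) = 0 ∧
  (hessian S xs
    + ∑ i, (α i * β i) • Matrix.vecMulVec (fun a => gradient (fun z => γ z i) xs a)
        (fun a => gradient (fun z => γ z i) xs a)
    + hessian (fun x => ∑ i, γ x i * P.kappa xs i) xs).PosDef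

end InputAffineSystem

/-- `Φ = ∑ (αᵢ/βᵢ) ln cosh (βᵢ (zᵢ - z⋆ᵢ))` as a function of `z`. -/
def potential {m : ℕ} (α β : Fin m → ℝ) (zs : Vec m) (z : Vec m) : ℝ :=
  ∑ i, α i / β i * Real.log (Real.cosh (β i * (z i - zs i)))

namespace InputAffineSystem

variable {n m : ℕ} (P : InputAffineSystem n m)

/-- The right-hand side `-∇Φ(γ(x)) - κ - ∑ eᵢ kᵢ tanh yᵢ` of the control law, as a function of
the state `x` and of the value `y` of the passive output. -/
def controlLaw (xs : Vec n) (α β k : Fin m → ℝ) (γ : Vec n → Vec m) (x : Vec n) (y : Vec m) :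
    Vec m :=
  -gradient (potential α β (γ xs)) (γ x) - P.kappa xs
    - ∑ i, (k i * Real.tanh (y i)) • EuclideanSpace.single i (1 : ℝ)

/-- The closed-loop vector field for the state feedback `u`. -/
def closedLoop (u : Vec n → Vec m) (x : Vec n) : Vec n :=
  P.velocity x (u x)

/-- `S_d = S + Φ ∘ γ + κᵀγ`. -/
def shapedStorage (S : Vec n → ℝ) (xs : Vec n) (α β : Fin m → ℝ) (γ : Vec n → Vec m)
    (x : Vec n) : ℝ :=
  S x + potential α β (γ xs) (γ x) + ∑ i, P.kappa xs i * γ x i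

end InputAffineSystem

end SaturatedPBC

end

/-!
The closed loop is analysed with the Lyapunov function `S_d = S + Φ ∘ γ + κᵀγ`.

**Well-posedness of the feedback.** The identity `γ̇ = y`, read for all inputs, says that
`y = b(x) + M(x) u` with `b = Dγ · f` and `M = Dγ · g = wᵀw + D`. So `M` is monotone, `b` and `M` are
locally Lipschitz whatever the regularity of `ℓ`, `w` and `D`, and the control law has the form
`u = c(x) - T (b(x) + M(x) u)`, where `T y = ∑ eᵢ kᵢ tanh yᵢ` is cocoercive and bounded. Cocoercivity
of `T` against monotonicity of `M` bounds the difference of two solutions by the difference of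
the data (`IsCocoercive.norm_sub_solution_le`). This gives uniqueness, the local Lipschitz
continuity of the feedback (`IsCocoercive.lipschitzNear`), and, with the inverse function theorem,
existence (`IsCocoercive.existsUnique`).

**Equilibrium.** Since `g⊥ f` vanishes at `x⋆`, `f⋆` lies in the range of `g⋆`, so `f⋆ = g⋆ κ` and the
velocity vanishes for `u = -κ`. The output then vanishes too, and `-κ` solves the control law at `x⋆`.

**Lyapunov function.** The first- and second-order conditions of the shaping assumption say that the
gradient of `S_d` vanishes at `x⋆` and that its derivative there is positive definite, so `x⋆` is a
strict local minimum. Along the closed loop the power balance reads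
`Ṡ_d = -‖ℓ + w u‖² - yᵀ T y ≤ 0` (`InputAffineSystem.inner_gradient_shapedStorage`). It vanishes only
if `y = 0` and `ℓ + w u = 0`, and then `u = -∇Φ - κ`; under the detectability condition this happens
only at `x⋆`, so that `S_d` is a strict Lyapunov function.

**Lyapunov's direct method.** Solutions are confined to a ball by comparing the values of the Lyapunov
function with those on the bounding sphere. They exist for all times because the field, Lipschitz on a
closed ball, extends to a bounded Lipschitz field, whose solutions are global and, by the same
confinement argument, never leave the ball.
-/

namespace SaturatedPBC

open Set Metric NNReal

/-! ### Solutions on `[0, ∞)` -/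

/-- `f` is Lipschitz on some neighbourhood of `x`. -/
def LipschitzNear {A B : Type*} [PseudoEMetricSpace A] [PseudoEMetricSpace B] (f : A → B) (x : A) :
    Prop :=
  ∃ K : ℝ≥0, ∃ t ∈ 𝓝 x, LipschitzOnWith K f t

theorem exists_isIntegralCurveOn_Ici_of_bounded {E : Type*} [NormedAddCommGroup E]
    [NormedSpace ℝ E] [CompleteSpace E] {v : E → E} {K L : ℝ≥0} (hv : LipschitzWith K v)
    (hL : ∀ x, ‖v x‖ ≤ L) (x₀ : E) :
    ∃ c : ℝ → E, c 0 = x₀ ∧ IsIntegralCurveOn c (fun _ => v) (Ici 0) := by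
  -- Picard–Lindelöf on `[0, N]`: in a ball of radius `L * N` the contraction needs no small time.
  have hex : ∀ N : ℕ, ∃ c : ℝ → E, c 0 = x₀ ∧ IsIntegralCurveOn c (fun _ => v) (Icc 0 (N : ℝ)) := by
    intro N
    have h := IsPicardLindelof.of_time_independent (f := v) (tmin := 0) (tmax := N)
      (t₀ := ⟨0, le_rfl, N.cast_nonneg⟩) (x₀ := x₀) (a := L * N) (r := 0) (L := L) (K := K)
      (fun x _ => hL x) hv.lipschitzOnWith (by simp)
    exact h.exists_eq_forall_mem_Icc_hasDerivWithinAt₀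
  choose c hc0 hc using hex
  have hagree : ∀ (M N : ℕ) (s : ℝ), 0 ≤ s → s ≤ M → s ≤ N → c M s = c N s := by
    intro M N s hs hM hN
    have aux : ∀ k : ℕ, s ≤ k → ContinuousOn (c k) (Icc 0 s) ∧
        ∀ t ∈ Ico 0 s, HasDerivWithinAt (c k) (v (c k t)) (Ici t) t := by
      intro k hk
      refine ⟨(hc k).continuousOn.mono (Icc_subset_Icc_right hk), fun t ht => ?_⟩
      have h1 := hc k t ⟨ht.1, ht.2.le.trans hk⟩
      have h2 : HasDerivWithinAt (c k) (v (c k t)) (Icc t k) t :=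
        h1.mono (Icc_subset_Icc_left ht.1)
      exact h2.mono_of_mem_nhdsWithin (Icc_mem_nhdsGE (ht.2.trans_le hk))
    exact ODE_solution_unique (v := fun _ => v) (fun _ => hv) (aux M hM).1 (aux M hM).2
      (aux N hN).1 (aux N hN).2 ((hc0 M).trans (hc0 N).symm) ⟨hs, le_rfl⟩
  refine ⟨fun t => c (⌈t⌉₊ + 1) t, by simpa using hc0 _, fun t ht => ?_⟩
  have ht' : (0 : ℝ) ≤ t := ht
  have hlt : t < ((⌈t⌉₊ + 1 : ℕ) : ℝ) := by
    push_cast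
    linarith [Nat.le_ceil t]
  have h1 := hc (⌈t⌉₊ + 1) t ⟨ht', hlt.le⟩
  have h2 : HasDerivWithinAt (fun t => c (⌈t⌉₊ + 1) t) (v (c (⌈t⌉₊ + 1) t))
      (Icc 0 ((⌈t⌉₊ + 1 : ℕ) : ℝ)) t := by
    refine h1.congr (fun s hs => hagree _ _ s hs.1 ?_ hs.2) rfl
    push_cast
    linarith [Nat.le_ceil s]
  refine h2.mono_of_mem_nhdsWithin ?_
  have : Icc (0 : ℝ) ((⌈t⌉₊ + 1 : ℕ) : ℝ) = Ici 0 ∩ Iic ((⌈t⌉₊ + 1 : ℕ) : ℝ) := by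
    ext; simp
  rw [this]
  exact Filter.inter_mem self_mem_nhdsWithin (mem_nhdsWithin_of_mem_nhds (Iic_mem_nhds hlt))

/-- Clamping the coordinates of a Lipschitz extension keeps it Lipschitz and makes it bounded. -/
theorem _root_.LipschitzOnWith.exists_bounded_extension {n : ℕ} {F : Vec n → Vec n} {K : ℝ≥0}
    {s : Set (Vec n)} (hF : LipschitzOnWith K F s) {B : ℝ} (hB : ∀ x ∈ s, ‖F x‖ ≤ B) :
    ∃ (G : Vec n → Vec n) (K' L : ℝ≥0), LipschitzWith K' G ∧ (∀ x, ‖G x‖ ≤ L) ∧ EqOn F G s := by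
  obtain ⟨G, hG, hFG⟩ := hF.extend_finite_dimension
  refine ⟨fun x => WithLp.toLp 2 fun i => max (-|B|) (min |B| (G x i)), _,
    ⟨√(∑ _i : Fin n, |B| ^ 2), Real.sqrt_nonneg _⟩,
    LipschitzWith.of_dist_le_mul fun x y => le_trans ?_ (hG.dist_le_mul x y), fun x => ?_,
    fun x hx => ?_⟩
  · rw [EuclideanSpace.dist_eq, EuclideanSpace.dist_eq]
    refine Real.sqrt_le_sqrt (Finset.sum_le_sum fun i _ => ?_)
    refine pow_le_pow_left₀ dist_nonneg ?_ 2
    rw [Real.dist_eq, Real.dist_eq]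
    refine (abs_max_sub_max_le_max _ _ _ _).trans ?_
    simp only [sub_self, abs_zero]
    refine max_le (abs_nonneg _) ((abs_min_sub_min_le_max _ _ _ _).trans ?_)
    simp
  · rw [EuclideanSpace.norm_eq]
    refine Real.sqrt_le_sqrt (Finset.sum_le_sum fun i _ => ?_)
    refine pow_le_pow_left₀ (norm_nonneg _) ?_ 2
    rw [Real.norm_eq_abs, abs_le]
    exact ⟨le_max_left _ _, max_le (by linarith [abs_nonneg B]) (min_le_left _ _)⟩
  · ext i
    have h1 : |F x i| ≤ |B| := by
      have := (PiLp.norm_apply_le (F x) i).trans ((hB x hx).trans (le_abs_self B))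
      simpa using this
    rw [abs_le] at h1
    simp [← hFG hx, h1.1, h1.2]

/-! ### Lyapunov's direct method -/

section Lyapunov

variable {n : ℕ} {F : Vec n → Vec n} {V : Vec n → ℝ} {c : ℝ → Vec n} {xs : Vec n}

/-- Along a solution `V` decreases at least at the rate `a`. -/
theorem antitoneOn_lyapunov {J : Set ℝ} {a : ℝ} (hJ : Convex ℝ J)
    (hc : IsIntegralCurveOn c (fun _ => F) J)
    (hV : ∀ t ∈ J, DifferentiableAt ℝ V (c t) ∧ inner ℝ (gradient V (c t)) (F (c t)) ≤ -a) :
    AntitoneOn (fun t => V (c t) + a * t) J := by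
  have hd : ∀ t ∈ interior J,
      HasDerivAt (fun t => V (c t) + a * t) (inner ℝ (gradient V (c t)) (F (c t)) + a * 1) t := by
    intro t ht
    have htJ := interior_subset ht
    have h1 : HasDerivAt c (F (c t)) t := (hc t htJ).hasDerivAt (mem_interior_iff_mem_nhds.1 ht)
    have h2 := ((hV t htJ).1.hasFDerivAt.comp_hasDerivAt t h1).add ((hasDerivAt_id t).const_mul a)
    rw [inner_gradient_left]
    exact h2
  refine antitoneOn_of_deriv_nonpos hJ ?_
    (fun t ht => (hd t ht).differentiableAt.differentiableWithinAt) fun t ht => ?_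
  · refine ContinuousOn.add (fun t ht => ?_) (by fun_prop)
    exact (hV t ht).1.continuousAt.comp_continuousWithinAt (hc.continuousOn t ht)
  · rw [(hd t ht).deriv]
    linarith [(hV t (interior_subset ht)).2]

/-- A curve that starts in a ball on a level of `V` below the values on the bounding sphere, and
that follows the field `F` as long as it is in the ball, does not leave the ball. The curve is not
required to follow `F` outside, so that the lemma also serves to confine the solutions of a
modified field. -/
theorem mem_ball_of_lyapunov {R η a b : ℝ}
    (hV : ∀ x ∈ closedBall xs R, DifferentiableAt ℝ V x ∧ inner ℝ (gradient V x) (F x) ≤ 0)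
    (hη : ∀ x ∈ sphere xs R, η ≤ V x) (hc : ContinuousOn c (Icc a b))
    (hd : ∀ t ∈ Icc a b, c t ∈ closedBall xs R → HasDerivWithinAt c (F (c t)) (Icc a b) t)
    (h0 : c a ∈ ball xs R) (h0' : V (c a) < η) :
    ∀ t ∈ Icc a b, c t ∈ ball xs R := by
  intro t ht
  by_contra hout
  have hg : ContinuousOn (fun s => dist (c s) xs) (Icc a t) :=
    continuous_dist.comp_continuousOn
      ((hc.mono (Icc_subset_Icc_right ht.2)).prodMk continuousOn_const)
  have hA : IsCompact (Icc a t ∩ (fun s => dist (c s) xs) ⁻¹' Ici R) :=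
    isCompact_Icc.of_isClosed_subset (hg.preimage_isClosed_of_isClosed isClosed_Icc isClosed_Ici)
      inter_subset_left
  -- `τ` is the first exit time
  obtain ⟨τ, ⟨hτ, hτR⟩, hmin⟩ := hA.exists_isLeast ⟨t, ⟨ht.1, le_rfl⟩, by simpa using hout⟩
  have hτR' : R ≤ dist (c τ) xs := hτR
  have hsub : Icc a τ ⊆ Icc a t := Icc_subset_Icc_right hτ.2
  obtain ⟨σ, hσ, hσR⟩ := intermediate_value_Icc hτ.1 (hg.mono hsub)
    (show R ∈ Icc (dist (c a) xs) (dist (c τ) xs) from ⟨(mem_ball.1 h0).le, hτR'⟩)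
  have hστ : σ = τ := le_antisymm hσ.2 (hmin ⟨hsub hσ, hσR.ge⟩)
  subst hστ
  have hin : ∀ s ∈ Icc a σ, c s ∈ closedBall xs R := by
    intro s hs
    rcases hs.2.eq_or_lt with h | h
    · rw [h]
      exact hσR.le
    · by_contra hcon
      exact absurd (hmin ⟨hsub hs, show R ≤ dist (c s) xs from (not_le.1 hcon).le⟩) (not_le.2 h)
  have hcurve : IsIntegralCurveOn c (fun _ => F) (Icc a σ) := fun s hs =>
    (hd s ⟨hs.1, hs.2.trans (hτ.2.trans ht.2)⟩ (hin s hs)).mono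
      (Icc_subset_Icc_right (hτ.2.trans ht.2))
  have hanti := antitoneOn_lyapunov (V := V) (a := 0) (convex_Icc a σ) hcurve
    (fun s hs => by simpa using hV _ (hin s hs)) ⟨le_rfl, hτ.1⟩ ⟨hτ.1, le_rfl⟩ hτ.1
  have := hη (c σ) hσR
  simp only [zero_mul, add_zero] at hanti
  linarith

/-- Small sublevel sets of a positive definite function confine the curves to a given ball. -/
theorem exists_pos_forall_mem_ball {R : ℝ} (hR : 0 < R)
    (hV : ∀ x ∈ closedBall xs R, DifferentiableAt ℝ V x ∧ inner ℝ (gradient V x) (F x) ≤ 0)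
    (hpos : ∀ x ∈ closedBall xs R, x ≠ xs → V xs < V x) :
    ∃ δ > 0, ∀ (a b : ℝ) (c : ℝ → Vec n), ContinuousOn c (Icc a b) →
      (∀ t ∈ Icc a b, c t ∈ closedBall xs R → HasDerivWithinAt c (F (c t)) (Icc a b) t) →
      dist (c a) xs < δ → ∀ t ∈ Icc a b, c t ∈ ball xs R := by
  have hη : ∃ η, V xs < η ∧ ∀ x ∈ sphere xs R, η ≤ V x := by
    rcases (sphere xs R).eq_empty_or_nonempty with h | h
    · exact ⟨V xs + 1, by linarith, by simp [h]⟩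
    · obtain ⟨z, hz, hmin⟩ := (isCompact_sphere xs R).exists_isMinOn h
        (f := V) fun x hx => (hV x (sphere_subset_closedBall hx)).1.continuousAt.continuousWithinAt
      exact ⟨V z, hpos z (sphere_subset_closedBall hz) (ne_of_mem_sphere hz hR.ne'), hmin⟩
  obtain ⟨η, hη1, hη2⟩ := hη
  have hcont : ContinuousAt V xs := (hV xs (mem_closedBall_self hR.le)).1.continuousAt
  obtain ⟨δ, hδ, hδV⟩ := Metric.eventually_nhds_iff.1 (hcont.eventually_lt_const hη1)
  exact ⟨min δ R, lt_min hδ hR, fun a b c hc hd h0 =>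
    mem_ball_of_lyapunov hV hη2 hc hd (h0.trans_le (min_le_right _ _))
      (hδV (h0.trans_le (min_le_left _ _)))⟩

variable {X : Set (Vec n)}

theorem IsLyapunovFunction.isStableEquilibrium (hV : IsLyapunovFunction X F xs V)
    (hF : LipschitzNear F xs) (hF0 : F xs = 0) : IsStableEquilibrium X F xs := by
  obtain ⟨U, hUX, hU, hxU, hVU, hpos, hdec⟩ := hV
  refine ⟨hUX hxU, hF0, fun ε hε => ?_⟩
  obtain ⟨K, s, hs, hK⟩ := hF
  obtain ⟨R₀, hR₀, hball⟩ := nhds_basis_closedBall.mem_iff.1 (Filter.inter_mem hs (hU.mem_nhds hxU))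
  set R := min R₀ ε
  have hR : 0 < R := lt_min hR₀ hε
  have hsub : closedBall xs R ⊆ s ∩ U :=
    (closedBall_subset_closedBall (min_le_left _ _)).trans hball
  have hVR : ∀ x ∈ closedBall xs R,
      DifferentiableAt ℝ V x ∧ inner ℝ (gradient V x) (F x) ≤ 0 := fun x hx =>
    ⟨(hVU.differentiableOn one_ne_zero).differentiableAt (hU.mem_nhds (hsub hx).2),
      hdec x (hsub hx).2⟩
  obtain ⟨δ, hδ, htrap⟩ := exists_pos_forall_mem_ball hR hVR fun x hx => hpos x (hsub hx).2
  refine ⟨δ, hδ, fun x₀ _ hx₀ => ⟨?_, ?_⟩⟩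
  · have hKR : LipschitzOnWith K F (closedBall xs R) := hK.mono fun x hx => (hsub hx).1
    obtain ⟨B, hB⟩ := (isCompact_closedBall xs R).exists_bound_of_continuousOn hKR.continuousOn
    obtain ⟨G, K', L, hG, hL, hFG⟩ := hKR.exists_bounded_extension hB
    obtain ⟨c, hc0, hc⟩ := exists_isIntegralCurveOn_Ici_of_bounded hG hL x₀
    have hin : ∀ t ∈ Ici (0 : ℝ), c t ∈ ball xs R := by
      intro t ht
      refine htrap 0 t c (hc.continuousOn.mono Icc_subset_Ici_self) (fun τ hτ hτR => ?_)
        (by rwa [hc0]) t ⟨ht, le_rfl⟩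
      rw [hFG hτR]
      exact (hc τ hτ.1).mono Icc_subset_Ici_self
    refine ⟨c, hc0, fun t ht => hUX (hsub (ball_subset_closedBall (hin t ht))).2, fun t ht => ?_⟩
    simp only [hFG (ball_subset_closedBall (hin t ht))]
    exact hc t ht
  · intro T c hc0 hc t ht
    exact (htrap 0 T c hc.2.continuousOn (fun τ hτ _ => hc.2 τ hτ) (by rwa [hc0]) t ht).trans_le
      (min_le_right _ _)

theorem LipschitzNear.continuousOn_nhds (hF : LipschitzNear F xs) :
    ∃ s ∈ 𝓝 xs, ContinuousOn F s :=
  let ⟨_, s, hs, h⟩ := hF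
  ⟨s, hs, h.continuousOn⟩

/-- If `V` decreases strictly away from `xs`, a solution cannot stay away from `xs`, since `V`
would decrease at a uniform rate; once close to `xs`, it remains close. -/
theorem IsLyapunovFunction.isAsymptoticallyStableEquilibrium (hV : IsLyapunovFunction X F xs V)
    (hF : LipschitzNear F xs) (hF0 : F xs = 0) {Ω : Set (Vec n)} (hΩ : Ω ∈ 𝓝 xs)
    (hneg : ∀ x ∈ Ω, x ≠ xs → inner ℝ (gradient V x) (F x) ≠ 0) :
    IsAsymptoticallyStableEquilibrium X F xs := by
  have hstab := hV.isStableEquilibrium hF hF0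
  refine ⟨hstab, ?_⟩
  obtain ⟨U, hUX, hU, hxU, hVU, hpos, hdec⟩ := hV
  obtain ⟨s, hs, hFs⟩ := hF.continuousOn_nhds
  obtain ⟨R, hR, hsub⟩ := nhds_basis_closedBall.mem_iff.1
    (Filter.inter_mem (Filter.inter_mem hs hΩ) (hU.mem_nhds hxU))
  obtain ⟨δ, hδ, hδR⟩ := hstab.2.2 R hR
  refine ⟨δ, hδ, fun c hc0 hc => ?_⟩
  have hin : ∀ t, 0 ≤ t → c t ∈ closedBall xs R := fun t ht =>
    ((hδR (c 0) (hc.1 self_mem_Ici) hc0).2 t c rfl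
      ⟨hc.1.mono_left Icc_subset_Ici_self, hc.2.mono Icc_subset_Ici_self⟩ t ⟨ht, le_rfl⟩).le
  have hdiff : ∀ x ∈ closedBall xs R, DifferentiableAt ℝ V x := fun x hx =>
    (hVU.differentiableOn one_ne_zero).differentiableAt (hU.mem_nhds (hsub hx).2)
  rw [Metric.tendsto_atTop]
  intro ε hε
  have hsub' : closedBall xs (min ε R) ⊆ closedBall xs R :=
    closedBall_subset_closedBall (min_le_right _ _)
  obtain ⟨δ', hδ', htrap⟩ := exists_pos_forall_mem_ball (F := F) (V := V) (lt_min hε hR)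
    (fun x hx => ⟨hdiff x (hsub' hx), hdec x (hsub (hsub' hx)).2⟩)
    fun x hx => hpos x (hsub (hsub' hx)).2
  -- either the solution comes so close to `xs` that it is confined to the `ε`-ball from then on,
  -- or it stays in a compact annulus, where `V` decreases at a positive rate `a`
  by_cases hreach : ∃ t₀, 0 ≤ t₀ ∧ dist (c t₀) xs < δ'
  · obtain ⟨t₀, ht₀, hd⟩ := hreach
    refine ⟨t₀, fun t ht => ?_⟩
    have hI : Icc t₀ t ⊆ Ici 0 := fun τ hτ => ht₀.trans hτ.1
    exact (htrap t₀ t c (hc.2.continuousOn.mono hI) (fun τ hτ _ => (hc.2 τ (hI hτ)).mono hI) hd t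
      ⟨ht, le_rfl⟩).trans_le (min_le_left _ _)
  · exfalso
    push Not at hreach
    set A : Set (Vec n) := closedBall xs R ∩ {x | δ' ≤ dist x xs}
    have hA : IsCompact A := (isCompact_closedBall xs R).inter_right
      (isClosed_le continuous_const (continuous_id.dist continuous_const))
    have hcA : ∀ t ∈ Ici (0 : ℝ), c t ∈ A := fun t ht => ⟨hin t ht, hreach t ht⟩
    have hgrad : ContinuousOn (gradient V) U :=
      (InnerProductSpace.toDual ℝ (Vec n)).symm.continuous.comp_continuousOn
        (hVU.continuousOn_fderiv_of_isOpen hU le_rfl)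
    have hcont : ContinuousOn (fun x => inner ℝ (gradient V x) (F x)) A :=
      (hgrad.mono fun x hx => (hsub hx.1).2).inner (hFs.mono fun x hx => (hsub hx.1).1.1)
    obtain ⟨z, hzA, hz⟩ := hA.exists_isMaxOn ⟨c 0, hcA 0 self_mem_Ici⟩ hcont
    have hzxs : z ≠ xs := fun h => by
      have : δ' ≤ dist z xs := hzA.2
      rw [h, dist_self] at this
      linarith
    have hza : inner ℝ (gradient V z) (F z) < 0 :=
      lt_of_le_of_ne (hdec z (hsub hzA.1).2) (hneg z (hsub hzA.1).1.2 hzxs)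
    set a := -inner ℝ (gradient V z) (F z)
    have ha : 0 < a := by linarith
    have hanti := antitoneOn_lyapunov (V := V) (a := a) (convex_Ici 0) hc.2 fun t ht =>
      ⟨hdiff _ (hcA t ht).1, by simpa [a] using hz (hcA t ht)⟩
    have hVlow : ∀ t, 0 ≤ t → V xs ≤ V (c t) := by
      intro t ht
      rcases eq_or_ne (c t) xs with h | h
      · rw [h]
      · exact (hpos _ (hsub (hin t ht)).2 h).le
    have hT : 0 ≤ (V (c 0) - V xs + 1) / a :=
      div_nonneg (by linarith [hVlow 0 le_rfl]) ha.le
    have h1 := hanti self_mem_Ici hT hT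
    simp only [mul_zero, add_zero, mul_div_cancel₀ _ ha.ne'] at h1
    linarith [hVlow _ hT]

end Lyapunov

/-! ### Feedback laws defined implicitly by a saturation -/

section Implicit

variable {E : Type*} [NormedAddCommGroup E] [InnerProductSpace ℝ E]

/-- `T` is cocoercive with modulus `μ`. For positive `μ` this makes `T` monotone and Lipschitz. -/
def IsCocoercive (μ : ℝ) (T : E → E) : Prop :=
  ∀ y z, μ * ‖T y - T z‖ ^ 2 ≤ inner ℝ (y - z) (T y - T z)

/-- The Lipschitz dependence of the solution `u` of `u = c - T (b + M u)`, for a monotone `M`, on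
the data `b`, `c` and `M`. -/
theorem IsCocoercive.norm_sub_solution_le {μ : ℝ} {T : E → E} (hT : IsCocoercive μ T)
    (hμ : 0 < μ) {C : ℝ} {M₁ M₂ : E →L[ℝ] E} (hM : ∀ v, 0 ≤ inner ℝ (M₂ v) v) (hC : ‖M₂‖ ≤ C)
    {b₁ b₂ c₁ c₂ u₁ u₂ : E}
    (h₁ : u₁ = c₁ - T (b₁ + M₁ u₁)) (h₂ : u₂ = c₂ - T (b₂ + M₂ u₂)) :
    ‖u₁ - u₂‖ ≤ (2 + (3 + 2 * C) / μ) *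
      (‖c₁ - c₂‖ + (‖b₁ - b₂‖ + ‖M₁ - M₂‖ * ‖u₁‖)) := by
  have hC0 : 0 ≤ C := (norm_nonneg _).trans hC
  set e := (b₁ - b₂) + (M₁ - M₂) u₁ with he_def
  set τ := T (b₁ + M₁ u₁) - T (b₂ + M₂ u₂) with hτ_def
  set δ := ‖c₁ - c₂‖ + (‖b₁ - b₂‖ + ‖M₁ - M₂‖ * ‖u₁‖) with hδ_def
  have he : ‖e‖ ≤ ‖b₁ - b₂‖ + ‖M₁ - M₂‖ * ‖u₁‖ :=
    (norm_add_le _ _).trans (add_le_add_right ((M₁ - M₂).le_opNorm u₁) _)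
  have hδc : ‖c₁ - c₂‖ ≤ δ := by
    have : 0 ≤ ‖b₁ - b₂‖ + ‖M₁ - M₂‖ * ‖u₁‖ := by positivity
    linarith
  have hδe : ‖e‖ ≤ δ := by linarith [norm_nonneg (c₁ - c₂)]
  have hδ0 : 0 ≤ δ := (norm_nonneg _).trans hδc
  have hdu : u₁ - u₂ = (c₁ - c₂) - τ := by
    rw [hτ_def]
    nth_rewrite 1 [h₁]
    nth_rewrite 1 [h₂]
    abel
  have hdy : (b₁ + M₁ u₁) - (b₂ + M₂ u₂) = e + M₂ (u₁ - u₂) := by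
    simp only [he_def, _root_.sub_apply, map_sub]
    abel
  have hdu_le : ‖u₁ - u₂‖ ≤ δ + ‖τ‖ := by
    rw [hdu]
    exact (norm_sub_le _ _).trans (by linarith)
  have hMu : ‖M₂ (u₁ - u₂)‖ ≤ C * (δ + ‖τ‖) :=
    (M₂.le_of_opNorm_le hC _).trans (mul_le_mul_of_nonneg_left hdu_le hC0)
  -- the monotonicity of `M₂` removes the only term that is quadratic in `u₁ - u₂`
  have key : μ * ‖τ‖ ^ 2 ≤ (δ + C * (δ + ‖τ‖)) * δ + δ * (δ + ‖τ‖) := by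
    have h1 := hT (b₁ + M₁ u₁) (b₂ + M₂ u₂)
    have hτ' : τ = (c₁ - c₂) - (u₁ - u₂) := by rw [hdu]; abel
    have h2 : inner ℝ (e + M₂ (u₁ - u₂)) τ =
        inner ℝ (e + M₂ (u₁ - u₂)) (c₁ - c₂) - inner ℝ e (u₁ - u₂)
          - inner ℝ (M₂ (u₁ - u₂)) (u₁ - u₂) := by
      rw [hτ', inner_sub_right, inner_add_left _ _ (u₁ - u₂)]
      ring
    rw [hdy, ← hτ_def, h2] at h1
    have h3 : inner ℝ (e + M₂ (u₁ - u₂)) (c₁ - c₂) ≤ (δ + C * (δ + ‖τ‖)) * δ :=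
      (real_inner_le_norm _ _).trans (mul_le_mul ((norm_add_le _ _).trans (add_le_add hδe hMu))
        hδc (norm_nonneg _) (by positivity))
    have h4 : -inner ℝ e (u₁ - u₂) ≤ δ * (δ + ‖τ‖) :=
      (neg_le_abs _).trans ((abs_real_inner_le_norm _ _).trans
        (mul_le_mul hδe hdu_le (norm_nonneg _) hδ0))
    linarith [hM (u₁ - u₂)]
  have hτδ : ‖τ‖ ≤ (1 + (3 + 2 * C) / μ) * δ := by
    have hq : 0 ≤ (3 + 2 * C) / μ * δ := by positivity
    -- for `‖τ‖ ≥ δ` the right-hand side of `key` is at most `(3 + 2 C) δ ‖τ‖`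
    rcases le_total ‖τ‖ δ with h | h
    · linarith
    · have h5 : ‖τ‖ * (μ * ‖τ‖) ≤ ‖τ‖ * ((3 + 2 * C) * δ) := by
        have h6 : δ * δ ≤ ‖τ‖ * δ := mul_le_mul_of_nonneg_right h hδ0
        nlinarith [mul_le_mul_of_nonneg_left h6 hC0]
      rcases (norm_nonneg τ).eq_or_lt with h0 | h0
      · rw [← h0]
        positivity
      · have h7 := le_of_mul_le_mul_left h5 h0
        have h8 : ‖τ‖ ≤ (3 + 2 * C) / μ * δ := by
          rw [div_mul_eq_mul_div, le_div_iff₀ hμ]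
          linarith
        linarith
  linarith

theorem IsCocoercive.antilipschitzWith {μ : ℝ} {T : E → E} (hT : IsCocoercive μ T) (hμ : 0 < μ)
    {M : E →L[ℝ] E} (hM : ∀ v, 0 ≤ inner ℝ (M v) v) (b : E) :
    ∃ K : ℝ≥0, AntilipschitzWith K fun u => u + T (b + M u) := by
  refine ⟨⟨2 + (3 + 2 * ‖M‖) / μ, by positivity⟩, AntilipschitzWith.of_le_mul_dist fun u v => ?_⟩
  rw [dist_eq_norm, dist_eq_norm]
  have := hT.norm_sub_solution_le hμ (M₁ := M) hM le_rfl (b₁ := b) (b₂ := b) (c₁ := u + T (b + M u))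
    (c₂ := v + T (b + M v)) (u₁ := u) (u₂ := v) (by simp) (by simp)
  simpa only [add_sub_cancel_right, sub_self, norm_zero, zero_mul, add_zero] using! this

theorem _root_.HasFDerivAt.injective_of_antilipschitzWith {F : E → E} {F' : E →L[ℝ] E} {K : ℝ≥0}
    {u : E} (hF : HasFDerivAt F F' u) (hK : AntilipschitzWith K F) : Function.Injective F' := by
  rw [injective_iff_map_eq_zero]
  intro v hv
  have h1 := ((hF.hasLineDerivAt v).tendsto_slope_zero.norm.const_mul (K : ℝ))
  rw [hv, norm_zero, mul_zero] at h1
  refine norm_le_zero_iff.1 (ge_of_tendsto h1 ?_)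
  filter_upwards [self_mem_nhdsWithin] with t ht
  have ht : t ≠ 0 := ht
  have h2 := hK.le_mul_dist (u + t • v) u
  rw [dist_eq_norm, dist_eq_norm, add_sub_cancel_left, norm_smul] at h2
  rw [norm_smul, norm_inv, mul_left_comm, inv_mul_eq_div, le_div_iff₀ (norm_pos_iff.2 ht)]
  linarith

/-- The map `u ↦ u + T (b + M u)` has a closed range, being antilipschitz, and an open range, by
the inverse function theorem; hence it is onto. -/
theorem IsCocoercive.existsUnique [FiniteDimensional ℝ E] {μ : ℝ} {T : E → E}
    (hT : IsCocoercive μ T) (hμ : 0 < μ) (hT1 : ContDiff ℝ 1 T)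
    {M : E →L[ℝ] E} (hM : ∀ v, 0 ≤ inner ℝ (M v) v) (b c : E) :
    ∃! u, u = c - T (b + M u) := by
  obtain ⟨K, hK⟩ := hT.antilipschitzWith hμ hM b
  set F : E → E := fun u => u + T (b + M u) with hF
  have hF1 : ContDiff ℝ 1 F := by fun_prop
  have hclosed : IsClosed (range F) := by
    rw [← isSeqClosed_iff_isClosed]
    intro s z hs hz
    choose v hv using hs
    have hcauchy : CauchySeq v := by
      have h1 := hz.cauchySeq
      rw [Metric.cauchySeq_iff'] at h1 ⊢
      intro ε hε
      obtain ⟨N, hN⟩ := h1 (ε / (K + 1)) (by positivity)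
      refine ⟨N, fun n hn => ?_⟩
      have h2 := hK.le_mul_dist (v n) (v N)
      have h3 := hN n hn
      rw [lt_div_iff₀ (by positivity)] at h3
      rw [hv, hv] at h2
      nlinarith [dist_nonneg (x := s n) (y := s N)]
    have : CompleteSpace E := FiniteDimensional.complete ℝ E
    obtain ⟨v', hv'⟩ := cauchySeq_tendsto_of_complete hcauchy
    refine ⟨v', tendsto_nhds_unique ?_ hz⟩
    have h4 := (hF1.continuous.tendsto v').comp hv'
    exact h4.congr hv
  have hopen : IsOpen (range F) := by
    rw [isOpen_iff_mem_nhds]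
    rintro _ ⟨v, rfl⟩
    have hs : HasStrictFDerivAt F (fderiv ℝ F v) v := hF1.contDiffAt.hasStrictFDerivAt one_ne_zero
    have hinj := hs.hasFDerivAt.injective_of_antilipschitzWith hK
    have : CompleteSpace E := FiniteDimensional.complete ℝ E
    have hmap := hs.map_nhds_eq_of_surj
      (LinearMap.range_eq_top.2 (LinearMap.injective_iff_surjective.1 hinj))
    rw [← hmap]
    exact Filter.range_mem_map
  have huniv : range F = univ := IsClopen.eq_univ ⟨hclosed, hopen⟩ (range_nonempty F)
  obtain ⟨u, hu⟩ : c ∈ range F := huniv ▸ mem_univ c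
  refine ⟨u, ?_, fun v hv => hK.injective ?_⟩
  · simp [← hu, hF]
  · rw [hu]
    nth_rewrite 1 [hF]
    simp only
    nth_rewrite 1 [hv]
    abel

/-! ### Local Lipschitz continuity -/

variable {A : Type*} [PseudoMetricSpace A] {x₀ : A}
  {G H : Type*} [NormedAddCommGroup G] [NormedAddCommGroup H]

theorem lipschitzNear_iff {f : A → G} :
    LipschitzNear f x₀ ↔ ∃ K : ℝ≥0, ∃ t ∈ 𝓝 x₀, ∀ x ∈ t, ∀ y ∈ t, ‖f x - f y‖ ≤ K * dist x y := by
  simp only [LipschitzNear, lipschitzOnWith_iff_dist_le_mul, dist_eq_norm]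

theorem LipschitzNear.exists_norm_le {f : A → G} (hf : LipschitzNear f x₀) :
    ∃ B : ℝ, ∀ᶠ x in 𝓝 x₀, ‖f x‖ ≤ B := by
  obtain ⟨K, t, ht, h⟩ := hf
  have hc : ContinuousAt f x₀ := h.continuousOn.continuousAt ht
  exact ⟨‖f x₀‖ + 1, (hc.norm.eventually_lt_const (lt_add_one _)).mono fun _ h => h.le⟩

theorem LipschitzNear.add {f g : A → G} (hf : LipschitzNear f x₀) (hg : LipschitzNear g x₀) :
    LipschitzNear (fun x => f x + g x) x₀ := by
  obtain ⟨K, t, ht, h⟩ := hf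
  obtain ⟨K', t', ht', h'⟩ := hg
  exact ⟨K + K', t ∩ t', Filter.inter_mem ht ht',
    (h.mono inter_subset_left).add (h'.mono inter_subset_right)⟩

theorem LipschitzNear.const (z : G) : LipschitzNear (fun _ : A => z) x₀ :=
  ⟨0, univ, Filter.univ_mem, (LipschitzWith.const z).lipschitzOnWith⟩

theorem LipschitzNear.sum {ι : Type*} (s : Finset ι) {f : ι → A → G}
    (hf : ∀ i ∈ s, LipschitzNear (f i) x₀) : LipschitzNear (fun x => ∑ i ∈ s, f i x) x₀ := by
  classical
  induction s using Finset.induction_on with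
  | empty => simpa using LipschitzNear.const 0
  | insert i s hi ih =>
    simp only [Finset.sum_insert hi]
    exact (hf i (Finset.mem_insert_self i s)).add
      (ih fun j hj => hf j (Finset.mem_insert_of_mem hj))

theorem _root_.LocallyLipschitzOn.lipschitzNear {f : A → G} {X : Set A}
    (hf : LocallyLipschitzOn X f) (hX : X ∈ 𝓝 x₀) : LipschitzNear f x₀ := by
  obtain ⟨K, t, ht, h⟩ := hf (mem_of_mem_nhds hX)
  exact ⟨K, t, (nhdsWithin_eq_nhds.2 hX) ▸ ht, h⟩

variable [NormedSpace ℝ G] [NormedSpace ℝ H]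

theorem LipschitzNear.bilin {F : Type*} [NormedAddCommGroup F] [NormedSpace ℝ F]
    (B : G →L[ℝ] H →L[ℝ] F) {f : A → G} {g : A → H}
    (hf : LipschitzNear f x₀) (hg : LipschitzNear g x₀) :
    LipschitzNear (fun x => B (f x) (g x)) x₀ := by
  obtain ⟨Cf, hCf⟩ := hf.exists_norm_le
  obtain ⟨Cg, hCg⟩ := hg.exists_norm_le
  rw [lipschitzNear_iff] at hf hg ⊢
  obtain ⟨K, t, ht, h⟩ := hf
  obtain ⟨K', t', ht', h'⟩ := hg
  refine ⟨‖B‖₊ * K * ‖Cg‖₊ + ‖B‖₊ * ‖Cf‖₊ * K', _,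
    Filter.inter_mem (Filter.inter_mem ht ht') (Filter.inter_mem hCf hCg), fun x hx y hy => ?_⟩
  have hsplit : B (f x) (g x) - B (f y) (g y) = B (f x - f y) (g x) + B (f y) (g x - g y) := by
    simp
  rw [hsplit]
  refine (norm_add_le _ _).trans ?_
  have e1 := B.le_opNorm₂ (f x - f y) (g x)
  have e2 := B.le_opNorm₂ (f y) (g x - g y)
  have e3 : ‖B‖ * ‖f x - f y‖ * ‖g x‖ ≤ ‖B‖ * (K * dist x y) * ‖Cg‖ := by
    gcongr
    · exact h x hx.1.1 y hy.1.1
    · exact (show ‖g x‖ ≤ Cg from hx.2.2).trans (Real.le_norm_self _)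
  have e4 : ‖B‖ * ‖f y‖ * ‖g x - g y‖ ≤ ‖B‖ * ‖Cf‖ * (K' * dist x y) := by
    gcongr
    · exact (show ‖f y‖ ≤ Cf from hy.2.1).trans (Real.le_norm_self _)
    · exact h' x hx.1.2 y hy.1.2
  push_cast
  linarith

theorem LipschitzNear.clm_apply {f : A → G →L[ℝ] H} {g : A → G}
    (hf : LipschitzNear f x₀) (hg : LipschitzNear g x₀) :
    LipschitzNear (fun x => f x (g x)) x₀ :=
  hf.bilin (ContinuousLinearMap.id ℝ (G →L[ℝ] H)) hg

theorem LipschitzNear.clm_comp {F : Type*} [NormedAddCommGroup F] [NormedSpace ℝ F]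
    {f : A → H →L[ℝ] F} {g : A → G →L[ℝ] H}
    (hf : LipschitzNear f x₀) (hg : LipschitzNear g x₀) :
    LipschitzNear (fun x => (f x).comp (g x)) x₀ :=
  hf.bilin (ContinuousLinearMap.compL ℝ G H F) hg

theorem LipschitzNear.smul_const {f : A → ℝ} (hf : LipschitzNear f x₀) (z : G) :
    LipschitzNear (fun x => f x • z) x₀ :=
  hf.bilin (ContinuousLinearMap.lsmul ℝ ℝ) (LipschitzNear.const z)

theorem _root_.ContDiffAt.lipschitzNear {f : G → H} {x : G} (hf : ContDiffAt ℝ 1 f x) :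
    LipschitzNear f x :=
  hf.exists_lipschitzOnWith

/-- If the data of `u = c - T (b + M u)` are Lipschitz near a point, so is the solution. The bound
on `T` is what bounds `u` a priori. -/
theorem IsCocoercive.lipschitzNear {μ B : ℝ} {T : E → E} (hT : IsCocoercive μ T) (hμ : 0 < μ)
    (hB : ∀ y, ‖T y‖ ≤ B) {b c u : A → E} {M : A → E →L[ℝ] E} (hb : LipschitzNear b x₀)
    (hc : LipschitzNear c x₀) (hM : LipschitzNear M x₀)
    (hmono : ∀ᶠ x in 𝓝 x₀, ∀ v, 0 ≤ inner ℝ (M x v) v)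
    (hu : ∀ᶠ x in 𝓝 x₀, u x = c x - T (b x + M x (u x))) : LipschitzNear u x₀ := by
  obtain ⟨CM, hCM⟩ := hM.exists_norm_le
  obtain ⟨Cc, hCc⟩ := hc.exists_norm_le
  rw [lipschitzNear_iff] at hb hc hM ⊢
  obtain ⟨Kb, tb, htb, hb⟩ := hb
  obtain ⟨Kc, tc, htc, hc⟩ := hc
  obtain ⟨KM, tM, htM, hM⟩ := hM
  refine ⟨(2 + (3 + 2 * ‖CM‖₊) / ‖μ‖₊) * (Kc + (Kb + KM * ‖Cc + B‖₊)), _, Filter.inter_mem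
    (Filter.inter_mem htb (Filter.inter_mem htc htM))
    (Filter.inter_mem (Filter.inter_mem hCM hCc) (Filter.inter_mem hmono hu)), ?_⟩
  rintro x ⟨⟨hxb, hxc, hxM⟩, ⟨hx1, hx2⟩, hx3, hx4⟩ y ⟨⟨hyb, hyc, hyM⟩, ⟨hy1, hy2⟩, hy3, hy4⟩
  have hux : ‖u x‖ ≤ ‖Cc + B‖ := by
    have h1 : ‖u x‖ ≤ ‖c x‖ + ‖T (b x + M x (u x))‖ := by
      nth_rewrite 1 [show u x = c x - T (b x + M x (u x)) from hx4]
      exact norm_sub_le _ _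
    exact (h1.trans (add_le_add hx2 (hB _))).trans (Real.le_norm_self _)
  have h2 := hT.norm_sub_solution_le hμ hy3 (hy1.trans (Real.le_norm_self CM)) hx4 hy4
  refine h2.trans ?_
  push_cast
  rw [Real.norm_of_nonneg hμ.le, mul_assoc]
  refine mul_le_mul_of_nonneg_left ?_ (by positivity)
  have h3 : ‖M x - M y‖ * ‖u x‖ ≤ KM * dist x y * ‖Cc + B‖ :=
    mul_le_mul (hM x hxM y hyM) hux (norm_nonneg _) (by positivity)
  linarith [hc x hxc y hyc, hb x hxb y hyb]

end Implicit

/-! ### The hyperbolic tangent and the potential -/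

theorem contDiff_tanh {k : WithTop ℕ∞} : ContDiff ℝ k Real.tanh := by
  rw [show Real.tanh = fun x => Real.sinh x / Real.cosh x from
    funext Real.tanh_eq_sinh_div_cosh]
  exact Real.contDiff_sinh.div Real.contDiff_cosh fun x => (Real.cosh_pos x).ne'

theorem hasDerivAt_tanh (x : ℝ) : HasDerivAt Real.tanh (1 - Real.tanh x ^ 2) x := by
  have h := (Real.hasDerivAt_sinh x).div (Real.hasDerivAt_cosh x) (Real.cosh_pos x).ne'
  have hc := (Real.cosh_pos x).ne'
  rw [show Real.tanh = fun x => Real.sinh x / Real.cosh x from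
    funext Real.tanh_eq_sinh_div_cosh]
  convert! h using 1
  field_simp

theorem tanh_monotone : Monotone Real.tanh :=
  monotone_of_deriv_nonneg (fun x => (hasDerivAt_tanh x).differentiableAt) fun x => by
    rw [(hasDerivAt_tanh x).deriv]
    linarith [Real.tanh_sq_lt_one x]

theorem sub_tanh_monotone : Monotone fun x => x - Real.tanh x :=
  monotone_of_deriv_nonneg (fun x => ((hasDerivAt_id x).sub (hasDerivAt_tanh x)).differentiableAt)
    fun x => by
      rw [((hasDerivAt_id' x).fun_sub (hasDerivAt_tanh x)).deriv]
      nlinarith [sq_nonneg (Real.tanh x)]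

/-- `tanh` is cocoercive, being increasing and nonexpansive. -/
theorem sq_tanh_sub_le (a b : ℝ) :
    (Real.tanh a - Real.tanh b) ^ 2 ≤ (a - b) * (Real.tanh a - Real.tanh b) := by
  rcases le_total a b with h | h
  · have h1 := tanh_monotone h
    have h2 := sub_tanh_monotone h
    simp only at h2
    nlinarith
  · have h1 := tanh_monotone h
    have h2 := sub_tanh_monotone h
    simp only at h2
    nlinarith

theorem mul_tanh_pos {a : ℝ} (ha : a ≠ 0) : 0 < a * Real.tanh a := by
  have h1 := sq_tanh_sub_le a 0
  have h2 : Real.tanh a ≠ 0 := fun h => ha (Real.tanh_injective (h.trans Real.tanh_zero.symm))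
  rw [Real.tanh_zero, sub_zero, sub_zero] at h1
  exact (sq_pos_of_ne_zero h2).trans_le h1

/-- The gradient `(αᵢ tanh (βᵢ (zᵢ - z⋆ᵢ)))ᵢ` of the potential. -/
noncomputable def gradPotential {m : ℕ} (α β : Fin m → ℝ) (zs z : Vec m) : Vec m :=
  WithLp.toLp 2 fun i => α i * Real.tanh (β i * (z i - zs i))

theorem hasGradientAt_potential {m : ℕ} {α β : Fin m → ℝ} (hβ : ∀ i, β i ≠ 0) (zs z : Vec m) :
    HasGradientAt (potential α β zs) (gradPotential α β zs z) z := by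
  rw [hasGradientAt_iff_hasFDerivAt]
  have hcoord : ∀ i, HasFDerivAt (fun z : Vec m => α i / β i * Real.log (Real.cosh
      (β i * (z i - zs i)))) ((α i * Real.tanh (β i * (z i - zs i))) •
        (EuclideanSpace.proj i : Vec m →L[ℝ] ℝ)) z := by
    intro i
    have h1 : HasFDerivAt (fun z : Vec m => z i) (EuclideanSpace.proj i : Vec m →L[ℝ] ℝ) z :=
      (EuclideanSpace.proj i : Vec m →L[ℝ] ℝ).hasFDerivAt
    have h2 : HasDerivAt (fun s : ℝ => α i / β i * Real.log (Real.cosh (β i * (s - zs i))))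
        (α i * Real.tanh (β i * (z i - zs i))) (z i) := by
      have h3 := ((((hasDerivAt_id (z i)).sub_const (zs i)).const_mul (β i)).cosh.log
        (Real.cosh_pos _).ne').const_mul (α i / β i)
      convert! h3 using 1
      rw [Real.tanh_eq_sinh_div_cosh]
      have := hβ i
      have := (Real.cosh_pos (β i * (z i - zs i))).ne'
      simp only [id]
      field_simp
    exact HasDerivAt.comp_hasFDerivAt (f := fun z : Vec m => z i) z h2 h1
  have hsum := HasFDerivAt.fun_sum (u := Finset.univ) fun i _ => hcoord i
  refine hsum.congr_fderiv ?_
  ext v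
  simp [gradPotential, PiLp.inner_apply, mul_comm]

theorem contDiff_gradPotential {m : ℕ} (α β : Fin m → ℝ) (zs : Vec m) {k : WithTop ℕ∞} :
    ContDiff ℝ k (gradPotential α β zs) := by
  rw [contDiff_euclidean]
  intro i
  have h : ContDiff ℝ k fun z : Vec m => z i := (EuclideanSpace.proj i : Vec m →L[ℝ] ℝ).contDiff
  exact contDiff_const.mul (contDiff_tanh.comp (contDiff_const.mul (h.sub contDiff_const)))

/-! ### The saturated damping term -/

/-- The saturation `y ↦ ∑ eᵢ kᵢ tanh yᵢ`. -/
noncomputable def saturation {m : ℕ} (k : Fin m → ℝ) (y : Vec m) : Vec m :=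
  ∑ i, (k i * Real.tanh (y i)) • EuclideanSpace.single i (1 : ℝ)

section Saturation

variable {m : ℕ} {k : Fin m → ℝ}

@[simp]
theorem saturation_apply (y : Vec m) (i : Fin m) : saturation k y i = k i * Real.tanh (y i) := by
  simp [saturation, Pi.single_apply]

theorem contDiff_saturation : ContDiff ℝ 1 (saturation k) := by
  rw [contDiff_euclidean]
  intro i
  simp only [saturation_apply]
  have h : ContDiff ℝ 1 fun z : Vec m => z i := (EuclideanSpace.proj i : Vec m →L[ℝ] ℝ).contDiff
  exact contDiff_const.mul (contDiff_tanh.comp h)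

theorem norm_saturation_le (y : Vec m) : ‖saturation k y‖ ≤ ∑ i, |k i| := by
  refine (norm_sum_le _ _).trans (Finset.sum_le_sum fun i _ => ?_)
  rw [norm_smul, PiLp.norm_single, norm_one, mul_one, norm_mul, Real.norm_eq_abs,
    Real.norm_eq_abs]
  exact mul_le_of_le_one_right (abs_nonneg _) (Real.abs_tanh_lt_one _).le

theorem exists_isCocoercive_saturation (hk : ∀ i, 0 < k i) :
    ∃ μ > 0, IsCocoercive μ (saturation k) := by
  have hK : 0 < 1 + ∑ i, k i := by
    have := Finset.sum_nonneg fun i (_ : i ∈ Finset.univ) => (hk i).le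
    linarith
  refine ⟨(1 + ∑ i, k i)⁻¹, inv_pos.2 hK, fun y z => ?_⟩
  rw [inv_mul_le_iff₀ hK, EuclideanSpace.real_norm_sq_eq, PiLp.inner_apply, Finset.mul_sum]
  refine Finset.sum_le_sum fun i _ => ?_
  have hki : k i ≤ 1 + ∑ j, k j := by
    have := Finset.single_le_sum (fun j _ => (hk j).le) (Finset.mem_univ i)
    linarith
  have h1 := sq_tanh_sub_le (y i) (z i)
  have h2 : (saturation k y - saturation k z) i = k i * (Real.tanh (y i) - Real.tanh (z i)) := by
    simp [mul_sub]
  have h3 : inner ℝ ((y - z) i) ((saturation k y - saturation k z) i) =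
      k i * ((y i - z i) * (Real.tanh (y i) - Real.tanh (z i))) := by
    rw [h2]
    simp only [PiLp.sub_apply, RCLike.inner_apply, conj_trivial]
    ring
  rw [h3, h2, mul_pow]
  have h4 : k i ^ 2 ≤ (1 + ∑ j, k j) * k i := by
    rw [sq]
    exact mul_le_mul_of_nonneg_right hki (hk i).le
  calc k i ^ 2 * (Real.tanh (y i) - Real.tanh (z i)) ^ 2
      ≤ (1 + ∑ j, k j) * k i * ((y i - z i) * (Real.tanh (y i) - Real.tanh (z i))) :=
        mul_le_mul h4 h1 (sq_nonneg _) (mul_nonneg hK.le (hk i).le)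
    _ = _ := by ring

theorem inner_saturation_nonneg (hk : ∀ i, 0 < k i) (y : Vec m) :
    0 ≤ inner ℝ y (saturation k y) := by
  rw [PiLp.inner_apply]
  refine Finset.sum_nonneg fun i _ => ?_
  rw [saturation_apply, RCLike.inner_apply, conj_trivial]
  rcases eq_or_ne (y i) 0 with h | h
  · simp [h]
  · nlinarith [mul_tanh_pos h, hk i, mul_pos (hk i) (mul_tanh_pos h)]

theorem inner_saturation_pos (hk : ∀ i, 0 < k i) {y : Vec m} (hy : y ≠ 0) :
    0 < inner ℝ y (saturation k y) := by
  obtain ⟨i, hi⟩ : ∃ i, y i ≠ 0 := by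
    by_contra! h
    exact hy (by ext i; simpa using h i)
  have hterm : ∀ j, inner ℝ (y j) (saturation k y j) = k j * (y j * Real.tanh (y j)) := by
    intro j
    rw [saturation_apply, RCLike.inner_apply, conj_trivial]
    ring
  rw [PiLp.inner_apply]
  simp only [hterm]
  refine Finset.sum_pos' (fun j _ => ?_) ⟨i, Finset.mem_univ i, mul_pos (hk i) (mul_tanh_pos hi)⟩
  rcases eq_or_ne (y j) 0 with h | h
  · simp [h]
  · exact (mul_pos (hk j) (mul_tanh_pos h)).le

end Saturation

/-! ### Strict local minima -/

section Minimum

variable {E : Type*} [NormedAddCommGroup E] [InnerProductSpace ℝ E]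

/-- Second-order sufficient condition. Near `xs` the gradient makes an acute angle with `x - xs`,
so that `φ` increases along the segment from `xs` to `x`. -/
theorem eventually_lt_of_hasFDerivAt_gradient [FiniteDimensional ℝ E] [CompleteSpace E] {φ : E → ℝ}
    {xs : E} {A : E →L[ℝ] E} (hφ : ∀ᶠ x in 𝓝 xs, DifferentiableAt ℝ φ x)
    (h0 : gradient φ xs = 0) (hA : HasFDerivAt (gradient φ) A xs)
    (hpos : ∀ v, v ≠ 0 → 0 < inner ℝ (A v) v) :
    ∀ᶠ x in 𝓝 xs, x ≠ xs → φ xs < φ x := by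
  obtain ⟨a, ha, hcoer⟩ : ∃ a > 0, ∀ v, a * ‖v‖ ^ 2 ≤ inner ℝ (A v) v := by
    rcases subsingleton_or_nontrivial E with hE | hE
    · exact ⟨1, one_pos, fun v => by simp [Subsingleton.elim v 0]⟩
    · have hc : Continuous fun v : E => inner ℝ (A v) v := by fun_prop
      obtain ⟨z, hz, hmin⟩ := (isCompact_sphere (0 : E) 1).exists_isMinOn
        (NormedSpace.sphere_nonempty.2 zero_le_one) hc.continuousOn
      refine ⟨inner ℝ (A z) z, hpos z (ne_of_mem_sphere hz one_ne_zero), fun v => ?_⟩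
      rcases eq_or_ne v 0 with rfl | hv
      · simp
      · have hn : ‖v‖ ≠ 0 := norm_ne_zero_iff.2 hv
        have h1 : inner ℝ (A z) z ≤ inner ℝ (A (‖v‖⁻¹ • v)) (‖v‖⁻¹ • v) :=
          hmin (by simp [norm_smul, hn])
        rw [map_smul, real_inner_smul_left, real_inner_smul_right, ← mul_assoc, ← mul_inv,
          ← sq, inv_mul_eq_div, le_div_iff₀ (by positivity)] at h1
        exact h1
  have hlo : ∀ᶠ x in 𝓝 xs, ‖gradient φ x - A (x - xs)‖ ≤ a / 2 * ‖x - xs‖ := by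
    have := hA.isLittleO.def (half_pos ha)
    simpa [h0] using this
  obtain ⟨ρ, hρ, hball⟩ := Metric.eventually_nhds_iff_ball.1 (hφ.and hlo)
  refine Metric.eventually_nhds_iff_ball.2 ⟨ρ, hρ, fun x hx hne => ?_⟩
  set v := x - xs
  have hv : v ≠ 0 := sub_ne_zero.2 hne
  have hseg : ∀ t ∈ Icc (0 : ℝ) 1, xs + t • v ∈ ball xs ρ := by
    intro t ht
    rw [mem_ball, dist_eq_norm, add_sub_cancel_left, norm_smul, Real.norm_of_nonneg ht.1]
    rw [mem_ball, dist_eq_norm] at hx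
    exact (mul_le_of_le_one_left (norm_nonneg _) ht.2).trans_lt hx
  have hd : ∀ t ∈ Icc (0 : ℝ) 1,
      HasDerivAt (fun t : ℝ => φ (xs + t • v)) (inner ℝ (gradient φ (xs + t • v)) v) t := by
    intro t ht
    have h1 : HasDerivAt (fun t : ℝ => xs + t • v) v t := by
      simpa using ((hasDerivAt_id t).smul_const v).const_add xs
    rw [inner_gradient_left]
    exact (hball _ (hseg t ht)).1.hasFDerivAt.comp_hasDerivAt t h1
  have hmono : StrictMonoOn (fun t : ℝ => φ (xs + t • v)) (Icc 0 1) := by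
    refine strictMonoOn_of_deriv_pos (convex_Icc 0 1)
      (fun t ht => (hd t ht).continuousAt.continuousWithinAt) fun t ht => ?_
    rw [interior_Icc] at ht
    have htI := Ioo_subset_Icc_self ht
    rw [(hd t htI).deriv]
    have h2 := (hball _ (hseg t htI)).2
    rw [add_sub_cancel_left, norm_smul, Real.norm_of_nonneg ht.1.le] at h2
    have h3 : inner ℝ (gradient φ (xs + t • v)) v =
        inner ℝ (gradient φ (xs + t • v) - A (t • v)) v + t * inner ℝ (A v) v := by
      rw [inner_sub_left, map_smul, real_inner_smul_left]
      ring
    have h4 := neg_le_of_abs_le (abs_real_inner_le_norm (gradient φ (xs + t • v) - A (t • v)) v)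
    have h5 := mul_le_mul_of_nonneg_right h2 (norm_nonneg v)
    have h6 := mul_le_mul_of_nonneg_left (hcoer v) ht.1.le
    have h7 : 0 < t * a * ‖v‖ ^ 2 :=
      mul_pos (mul_pos ht.1 ha) (pow_pos (norm_pos_iff.2 hv) 2)
    rw [h3]
    nlinarith
  have := hmono ⟨le_rfl, zero_le_one⟩ ⟨zero_le_one, le_rfl⟩ zero_lt_one
  simpa [v] using this

end Minimum

/-! ### Gradients and Hessians -/

theorem inner_transpose_toEuclideanLin {a b : ℕ} (A : Matrix (Fin a) (Fin b) ℝ) (y : Vec a)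
    (x : Vec b) : inner ℝ (Aᵀ.toEuclideanLin y) x = inner ℝ y (A.toEuclideanLin x) := by
  rw [← Matrix.conjTranspose_eq_transpose_of_trivial,
    Matrix.toEuclideanLin_conjTranspose_eq_adjoint,
    LinearMap.adjoint_inner_left]

/-- A skew-symmetric matrix has no quadratic form. -/
theorem inner_skew {a : ℕ} {A : Matrix (Fin a) (Fin a) ℝ} (hA : A = -Aᵀ) (v : Vec a) :
    inner ℝ (A.toEuclideanLin v) v = 0 := by
  have h : inner ℝ (A.toEuclideanLin v) v = -inner ℝ (A.toEuclideanLin v) v := by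
    nth_rewrite 1 [hA]
    rw [map_neg, LinearMap.neg_apply, inner_neg_left, inner_transpose_toEuclideanLin,
      real_inner_comm]
  linarith

theorem inner_toEuclideanLin_gram {a b : ℕ} (A : Matrix (Fin a) (Fin b) ℝ) (v : Vec b) :
    inner ℝ ((Aᵀ * A).toEuclideanLin v) v = ‖A.toEuclideanLin v‖ ^ 2 := by
  have h : (Aᵀ * A).toEuclideanLin v = Aᵀ.toEuclideanLin (A.toEuclideanLin v) := by
    simp [Matrix.toLpLin_apply, Matrix.mulVec_mulVec]
  rw [h, inner_transpose_toEuclideanLin, real_inner_self_eq_norm_sq]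

section Hessian

variable {n : ℕ} {φ : Vec n → ℝ} {x : Vec n}

theorem _root_.ContDiffAt.differentiableAt_gradient (h : ContDiffAt ℝ 2 φ x) :
    DifferentiableAt ℝ (gradient φ) x := by
  have h1 : DifferentiableAt ℝ (fderiv ℝ φ) x :=
    (h.fderiv_right (m := 1) (by norm_num)).differentiableAt one_ne_zero
  exact (InnerProductSpace.toDual ℝ (Vec n)).symm.toContinuousLinearEquiv.differentiableAt.comp x h1

theorem toEuclideanLin_hessian (v : Vec n) :
    (hessian φ x).toEuclideanLin v = fderiv ℝ (gradient φ) x v := by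
  have hv : v = ∑ j, v j • EuclideanSpace.single j (1 : ℝ) := by
    ext i
    simp [Pi.single_apply]
  conv_rhs => rw [hv, map_sum]
  ext i
  simp [hessian, Matrix.mulVec, dotProduct, mul_comm]

theorem toEuclideanLin_vecMulVec (a v : Vec n) :
    (Matrix.vecMulVec (fun i => a i) (fun i => a i)).toEuclideanLin v = inner ℝ a v • a := by
  ext i
  simp [Matrix.mulVec, dotProduct, Matrix.vecMulVec_apply, PiLp.inner_apply, Finset.sum_mul]
  exact Finset.sum_congr rfl fun j _ => by ring

theorem inner_pos_of_posDef {H : Matrix (Fin n) (Fin n) ℝ} (hH : H.PosDef) {v : Vec n}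
    (hv : v ≠ 0) : 0 < inner ℝ (H.toEuclideanLin v) v := by
  have h := hH.dotProduct_mulVec_pos (x := WithLp.ofLp v) (by simpa using hv)
  simpa [EuclideanSpace.inner_eq_star_dotProduct, dotProduct_comm] using h

end Hessian

namespace InputAffineSystem

/-! ### The closed loop -/

variable {n m r : ℕ} {P : InputAffineSystem n m}

/-- The input matrix as a continuous linear map. -/
noncomputable def inputMap (P : InputAffineSystem n m) (x : Vec n) : Vec m →L[ℝ] Vec n :=
  LinearMap.toContinuousLinearMap (P.g x).toEuclideanLin

theorem lipschitzNear_inputMap {x : Vec n} (hx : x ∈ P.X) : LipschitzNear P.inputMap x := by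
  let T : Fin n → Fin m → Vec m →L[ℝ] Vec n := fun i j =>
    LinearMap.toContinuousLinearMap (Matrix.toEuclideanLin (Matrix.single i j (1 : ℝ)))
  have h : P.inputMap = fun x => ∑ i, ∑ j, P.g x i j • T i j := by
    funext x
    refine ContinuousLinearMap.coe_injective ?_
    have hT : ∀ i j, (T i j : Vec m →ₗ[ℝ] Vec n) =
        Matrix.toEuclideanLin (Matrix.single i j (1 : ℝ)) := fun i j => rfl
    have hsingle : ∀ i j, Matrix.single i j (P.g x i j) =
        P.g x i j • Matrix.single i j (1 : ℝ) := fun i j => by simp [Matrix.smul_single]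
    rw [ContinuousLinearMap.toLinearMap_sum]
    simp only [ContinuousLinearMap.toLinearMap_sum, ContinuousLinearMap.toLinearMap_smul, hT,
      ← map_smul, ← hsingle, ← map_sum]
    rw [inputMap, LinearMap.coe_toContinuousLinearMap]
    exact congrArg _ (Matrix.matrix_eq_sum_single (P.g x))
  rw [h]
  exact LipschitzNear.sum _ fun i _ => LipschitzNear.sum _ fun j _ =>
    ((P.lipschitz_g i j).lipschitzNear (P.isOpen_X.mem_nhds hx)).smul_const (T i j)

/-- At an assignable equilibrium the input `-κ` makes the velocity vanish: the drift lies in the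
kernel of the annihilator, which for dimensional reasons is the range of the input matrix. -/
theorem velocity_neg_kappa {N : Vec n → Matrix (Fin (n - m)) (Fin n) ℝ}
    (hN : P.IsLeftAnnihilator N) {xs : Vec n} (hxs : xs ∈ P.assignableEquilibria N) :
    P.velocity xs (-P.kappa xs) = 0 := by
  obtain ⟨hX, hf⟩ := hxs
  obtain ⟨hNg, hrN⟩ := hN xs hX
  have hrg := P.rank_g xs hX
  set g := P.g xs
  have hmn : m ≤ n := by
    have := g.rank_le_height
    omega
  have hker : LinearMap.range g.mulVecLin = LinearMap.ker (N xs).mulVecLin := by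
    apply Submodule.eq_of_le_of_finrank_eq
    · rintro _ ⟨z, rfl⟩
      simp [hNg]
    · have h1 := (N xs).mulVecLin.finrank_range_add_finrank_ker
      have h2 : Module.finrank ℝ (LinearMap.range (N xs).mulVecLin) = n - m := hrN
      have h3 : Module.finrank ℝ (LinearMap.range g.mulVecLin) = m := hrg
      rw [h2, Module.finrank_fin_fun] at h1
      omega
  have hmem : WithLp.ofLp (P.f xs) ∈ LinearMap.ker (N xs).mulVecLin := by
    simpa [Matrix.toLpLin_apply] using hf
  rw [← hker] at hmem
  obtain ⟨z, hz⟩ := hmem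
  have hunit : IsUnit (gᵀ * g) := by
    rw [← Matrix.mulVec_surjective_iff_isUnit]
    have h4 : (gᵀ * g).rank = m := by rw [Matrix.rank_transpose_mul_self, hrg]
    have h5 : LinearMap.range (gᵀ * g).mulVecLin = ⊤ :=
      Submodule.eq_top_of_finrank_eq (by rw [Module.finrank_fin_fun]; exact h4)
    exact LinearMap.range_eq_top.1 h5
  have hz' : g *ᵥ z = WithLp.ofLp (P.f xs) := hz
  have hκ : WithLp.ofLp (P.kappa xs) = z := by
    have : WithLp.ofLp (P.kappa xs) = ((gᵀ * g)⁻¹ * gᵀ) *ᵥ WithLp.ofLp (P.f xs) := rfl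
    rw [this, ← hz', Matrix.mulVec_mulVec, Matrix.mul_assoc,
      Matrix.nonsing_inv_mul _ ((Matrix.isUnit_iff_isUnit_det _).1 hunit), Matrix.one_mulVec]
  have hg : g.toEuclideanLin (P.kappa xs) = P.f xs := by
    rw [Matrix.toLpLin_apply, hκ, hz']
  rw [velocity, map_neg, hg, add_neg_cancel]

variable {S : Vec n → ℝ} {l : Vec n → Vec r} {w : Vec n → Matrix (Fin r) (Fin m) ℝ}
  {D : Vec n → Matrix (Fin m) (Fin m) ℝ} {xs : Vec n} {α β k : Fin m → ℝ} {γ : Vec n → Vec m}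

/-- The output is affine in the input, with coefficients given by the derivative of `γ` along the
drift and along the input directions. In particular the coefficients are as regular as `f`, `g` and
the derivative of `γ`, although nothing is assumed of `l`, `w` and `D`. -/
theorem IsShaping.output_eq (hγ : P.IsShaping S l w D xs α β γ) {x : Vec n} (hx : x ∈ P.X)
    (u : Vec m) : P.output S l w D x u =
      fderiv ℝ γ x (P.f x) + ((fderiv ℝ γ x).comp (P.inputMap x)) u := by
  rw [← hγ.2.1 x hx u, velocity, map_add]
  rfl

/-- The coefficient of `u` in the output is `wᵀw + D`, a positive semidefinite matrix plus a
skew-symmetric one. -/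
theorem IsShaping.inner_nonneg (hγ : P.IsShaping S l w D xs α β γ) {x : Vec n} (hx : x ∈ P.X)
    (hD : D x = -(D x)ᵀ) (v : Vec m) :
    0 ≤ inner ℝ (((fderiv ℝ γ x).comp (P.inputMap x)) v) v := by
  have h0 := hγ.output_eq hx 0
  have hv := hγ.output_eq hx v
  have h1 : ((fderiv ℝ γ x).comp (P.inputMap x)) v =
      ((w x)ᵀ * w x + D x).toEuclideanLin v := by
    rw [map_zero, add_zero] at h0
    rw [← h0, output, output, map_zero, add_zero, add_right_inj] at hv
    exact hv.symm
  rw [h1, map_add, LinearMap.add_apply, inner_add_left, inner_skew hD, add_zero,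
    inner_toEuclideanLin_gram]
  positivity

theorem controlLaw_eq (hβ : ∀ i, 0 < β i) (x : Vec n) (y : Vec m) :
    P.controlLaw xs α β k γ x y =
      (-gradPotential α β (γ xs) (γ x) - P.kappa xs) - saturation k y := by
  rw [controlLaw, (hasGradientAt_potential (fun i => (hβ i).ne') _ _).gradient]
  rfl

theorem existsUnique_controlLaw (hβ : ∀ i, 0 < β i) (hk : ∀ i, 0 < k i)
    (hγ : P.IsShaping S l w D xs α β γ) {x : Vec n} (hx : x ∈ P.X) (hD : D x = -(D x)ᵀ) :
    ∃! v : Vec m, v = P.controlLaw xs α β k γ x (P.output S l w D x v) := by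
  obtain ⟨μ, hμ, hT⟩ := exists_isCocoercive_saturation hk
  have := hT.existsUnique hμ contDiff_saturation (hγ.inner_nonneg hx hD)
    (fderiv ℝ γ x (P.f x)) (-gradPotential α β (γ xs) (γ x) - P.kappa xs)
  simpa only [controlLaw_eq hβ, hγ.output_eq hx] using this

theorem controlLaw_mem_Icc (hα : ∀ i, 0 < α i) (hβ : ∀ i, 0 < β i) (hk : ∀ i, 0 < k i) (x : Vec n)
    (y : Vec m) (i : Fin m) : P.controlLaw xs α β k γ x y i ∈
      Icc (-P.kappa xs i - k i - α i) (-P.kappa xs i + k i + α i) := by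
  rw [controlLaw_eq hβ]
  simp only [PiLp.sub_apply, PiLp.neg_apply, saturation_apply, gradPotential]
  have h1 := Real.tanh_lt_one (y i)
  have h2 := Real.neg_one_lt_tanh (y i)
  have h3 := Real.tanh_lt_one (β i * (γ x i - γ xs i))
  have h4 := Real.neg_one_lt_tanh (β i * (γ x i - γ xs i))
  have h5 := hα i
  have h6 := hk i
  constructor <;> nlinarith

variable {u : Vec n → Vec m}

/-- At the equilibrium `-κ` solves the control law, since it makes the output vanish. -/
theorem feedback_eq_neg_kappa {N : Vec n → Matrix (Fin (n - m)) (Fin n) ℝ}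
    (hN : P.IsLeftAnnihilator N) (hxs : xs ∈ P.assignableEquilibria N)
    (hβ : ∀ i, 0 < β i) (hk : ∀ i, 0 < k i) (hγ : P.IsShaping S l w D xs α β γ)
    (hD : D xs = -(D xs)ᵀ)
    (hu : u xs = P.controlLaw xs α β k γ xs (P.output S l w D xs (u xs))) :
    u xs = -P.kappa xs := by
  refine (existsUnique_controlLaw hβ hk hγ hxs.1 hD).unique hu ?_
  have hy : P.output S l w D xs (-P.kappa xs) = 0 := by
    rw [← hγ.2.1 xs hxs.1, velocity_neg_kappa hN hxs, map_zero]
  rw [hy, controlLaw_eq hβ]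
  ext i
  simp [gradPotential]

theorem lipschitzNear_closedLoop (hβ : ∀ i, 0 < β i) (hk : ∀ i, 0 < k i)
    (hγ : P.IsShaping S l w D xs α β γ) (hD : ∀ x ∈ P.X, D x = -(D x)ᵀ)
    (hu : ∀ x ∈ P.X, u x = P.controlLaw xs α β k γ x (P.output S l w D x (u x)))
    (hx : xs ∈ P.X) : LipschitzNear (P.closedLoop u) xs := by
  have hX : P.X ∈ 𝓝 xs := P.isOpen_X.mem_nhds hx
  have hγ2 : ContDiffAt ℝ 2 γ xs := hγ.1.contDiffAt hX
  have hf : LipschitzNear P.f xs := P.lipschitz_f.lipschitzNear hX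
  have hg := lipschitzNear_inputMap hx
  have hdγ : LipschitzNear (fderiv ℝ γ) xs :=
    (hγ2.fderiv_right (m := 1) (by norm_num)).lipschitzNear
  have hc : LipschitzNear (fun x => -gradPotential α β (γ xs) (γ x) - P.kappa xs) xs :=
    ((((contDiff_gradPotential α β (γ xs)).contDiffAt.comp xs
      (hγ2.of_le (by norm_num))).neg).sub contDiffAt_const).lipschitzNear
  obtain ⟨μ, hμ, hT⟩ := exists_isCocoercive_saturation hk
  have hul : LipschitzNear u xs := by
    refine hT.lipschitzNear hμ norm_saturation_le (hdγ.clm_apply hf) hc (hdγ.clm_comp hg)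
      ?_ ?_
    · filter_upwards [hX] with x hx v using hγ.inner_nonneg hx (hD x hx) v
    · filter_upwards [hX] with x hx
      nth_rewrite 1 [hu x hx]
      rw [controlLaw_eq hβ, hγ.output_eq hx]
  exact hf.add (hg.clm_apply hul)

/-! ### The shaped storage function -/

section Storage

variable {x : Vec n}

/-- The function `γᵀκ`. -/
noncomputable def shapedLinear (P : InputAffineSystem n m) (xs : Vec n) (γ : Vec n → Vec m)
    (x : Vec n) : ℝ :=
  ∑ i, γ x i * P.kappa xs i

theorem inner_gradient_component (hγ : DifferentiableAt ℝ γ x) (i : Fin m) (v : Vec n) :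
    inner ℝ (gradient (fun z => γ z i) x) v = fderiv ℝ γ x v i := by
  rw [inner_gradient_left]
  have h : HasFDerivAt (fun z => γ z i) ((EuclideanSpace.proj i : Vec m →L[ℝ] ℝ).comp
      (fderiv ℝ γ x)) x := (EuclideanSpace.proj i : Vec m →L[ℝ] ℝ).hasFDerivAt.comp x
        hγ.hasFDerivAt
  rw [h.fderiv]
  rfl

theorem hasFDerivAt_shapedLinear (hγ : DifferentiableAt ℝ γ x) :
    HasFDerivAt (P.shapedLinear xs γ)
      ((innerSL ℝ (P.kappa xs)).comp (fderiv ℝ γ x)) x := by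
  have h := (innerSL ℝ (P.kappa xs)).hasFDerivAt.comp x hγ.hasFDerivAt
  have hfun : P.shapedLinear xs γ = innerSL ℝ (P.kappa xs) ∘ γ := by
    funext z
    simp [shapedLinear, PiLp.inner_apply]
  rwa [hfun]

theorem hasFDerivAt_shapedStorage (hβ : ∀ i, 0 < β i) (hS : DifferentiableAt ℝ S x)
    (hγ : DifferentiableAt ℝ γ x) :
    HasFDerivAt (P.shapedStorage S xs α β γ) (fderiv ℝ S x +
      (innerSL ℝ (gradPotential α β (γ xs) (γ x) + P.kappa xs)).comp (fderiv ℝ γ x)) x := by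
  have h1 := (hasGradientAt_potential (α := α) (fun i => (hβ i).ne') (γ xs) (γ x)).hasFDerivAt.comp
    x hγ.hasFDerivAt
  have h2 := (hS.hasFDerivAt.add h1).add (hasFDerivAt_shapedLinear (P := P) (xs := xs) hγ)
  have hfun : P.shapedStorage S xs α β γ =
      fun x => S x + potential α β (γ xs) (γ x) + P.shapedLinear xs γ x := by
    funext z
    simp [shapedStorage, shapedLinear, mul_comm]
  rw [hfun]
  refine h2.congr_fderiv ?_
  ext v
  simp [add_assoc]

theorem gradient_shapedStorage (hβ : ∀ i, 0 < β i) (hS : DifferentiableAt ℝ S x)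
    (hγ : DifferentiableAt ℝ γ x) :
    gradient (P.shapedStorage S xs α β γ) x = gradient S x
      + ∑ i, (α i * Real.tanh (β i * (γ x i - γ xs i))) • gradient (fun z => γ z i) x
      + gradient (P.shapedLinear xs γ) x := by
  refine ext_inner_right ℝ fun v => ?_
  rw [inner_gradient_left, (hasFDerivAt_shapedStorage hβ hS hγ).fderiv, inner_add_left,
    inner_add_left, inner_gradient_left, inner_gradient_left,
    (hasFDerivAt_shapedLinear hγ).fderiv, sum_inner]
  simp only [real_inner_smul_left, inner_gradient_component hγ]
  simp [PiLp.inner_apply, gradPotential, add_assoc, mul_comm]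

theorem gradient_shapedLinear (hγ : DifferentiableAt ℝ γ x) :
    gradient (P.shapedLinear xs γ) x = (jacobian γ x).toEuclideanLin (P.kappa xs) := by
  have h : gradient (P.shapedLinear xs γ) x =
      ∑ i, P.kappa xs i • gradient (fun z => γ z i) x := by
    refine ext_inner_right ℝ fun v => ?_
    rw [inner_gradient_left, (hasFDerivAt_shapedLinear hγ).fderiv, sum_inner]
    simp only [real_inner_smul_left, inner_gradient_component hγ]
    simp [PiLp.inner_apply, mul_comm]
  rw [h]
  ext a
  simp [jacobian, Matrix.toLpLin_apply, Matrix.mulVec, dotProduct, mul_comm]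

theorem gradient_shapedStorage_self (hβ : ∀ i, 0 < β i) (hS : DifferentiableAt ℝ S xs)
    (hγ : DifferentiableAt ℝ γ xs)
    (h0 : gradient S xs + (jacobian γ xs).toEuclideanLin (P.kappa xs) = 0) :
    gradient (P.shapedStorage S xs α β γ) xs = 0 := by
  rw [gradient_shapedStorage hβ hS hγ, gradient_shapedLinear hγ]
  simpa using h0

/-- The derivatives of the factors `αᵢ tanh (βᵢ (γᵢ - γᵢ⋆))` contribute the rank-one matrices; those
of the gradients `∇γᵢ` drop out, as the factors vanish at `xs`. -/
theorem hasFDerivAt_gradient_shapedStorage (hβ : ∀ i, 0 < β i)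
    (hS : ContDiffAt ℝ 2 S xs) (hγ : ContDiffAt ℝ 2 γ xs) :
    HasFDerivAt (gradient (P.shapedStorage S xs α β γ)) (LinearMap.toContinuousLinearMap
      (hessian S xs
        + ∑ i, (α i * β i) • Matrix.vecMulVec (fun a => gradient (fun z => γ z i) xs a)
          (fun a => gradient (fun z => γ z i) xs a)
        + hessian (P.shapedLinear xs γ) xs).toEuclideanLin) xs := by
  have hγi : ∀ i, ContDiffAt ℝ 2 (fun z => γ z i) xs := fun i =>
    (EuclideanSpace.proj i : Vec m →L[ℝ] ℝ).contDiff.contDiffAt.comp xs hγ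
  have hlin : ContDiffAt ℝ 2 (P.shapedLinear xs γ) xs :=
    ContDiffAt.sum fun i _ => (hγi i).mul contDiffAt_const
  have hcoef : ∀ i, HasFDerivAt (fun x => α i * Real.tanh (β i * (γ x i - γ xs i)))
      ((α i * β i) • fderiv ℝ (fun z => γ z i) xs) xs := by
    intro i
    have h1 : HasDerivAt (fun s : ℝ => α i * Real.tanh (β i * (s - γ xs i))) (α i * β i)
        (γ xs i) := by
      have h2 := (((hasDerivAt_id (γ xs i)).sub_const (γ xs i)).const_mul (β i))
      have h3 := ((hasDerivAt_tanh _).comp _ h2).const_mul (α i)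
      simpa using h3
    exact HasDerivAt.comp_hasFDerivAt (f := fun z => γ z i) xs h1
      ((hγi i).differentiableAt two_ne_zero).hasFDerivAt
  have hsum := HasFDerivAt.fun_sum (u := Finset.univ) fun i _ =>
    (hcoef i).smul (hγi i).differentiableAt_gradient.hasFDerivAt
  have htot := (hS.differentiableAt_gradient.hasFDerivAt.add hsum).add
    hlin.differentiableAt_gradient.hasFDerivAt
  have hev : gradient (P.shapedStorage S xs α β γ) =ᶠ[𝓝 xs] fun x => gradient S x
      + ∑ i, (α i * Real.tanh (β i * (γ x i - γ xs i))) • gradient (fun z => γ z i) x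
      + gradient (P.shapedLinear xs γ) x := by
    filter_upwards [hS.eventually (by simp), hγ.eventually (by simp)] with x h1 h2
    exact gradient_shapedStorage hβ (h1.differentiableAt two_ne_zero)
      (h2.differentiableAt two_ne_zero)
  refine (htot.congr_of_eventuallyEq hev).congr_fderiv ?_
  ext1 v
  rw [LinearMap.coe_toContinuousLinearMap']
  simp only [map_add, map_sum, map_smul, LinearMap.add_apply, LinearMap.sum_apply,
    LinearMap.smul_apply]
  rw [toEuclideanLin_hessian, toEuclideanLin_hessian]
  simp [toEuclideanLin_vecMulVec, mul_smul, inner_gradient_left]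

/-- Along the closed loop, the power balance is `-‖ℓ + w u‖² - yᵀ T y`, with `T` the saturation. -/
theorem inner_gradient_shapedStorage (hβ : ∀ i, 0 < β i) (hS : P.IsStorage S l)
    (hγ : P.IsShaping S l w D xs α β γ) (hx : x ∈ P.X) (hD : D x = -(D x)ᵀ) {v : Vec m}
    (hv : v = P.controlLaw xs α β k γ x (P.output S l w D x v)) :
    inner ℝ (gradient (P.shapedStorage S xs α β γ) x) (P.velocity x v) =
      -‖l x + (w x).toEuclideanLin v‖ ^ 2
        - inner ℝ (P.output S l w D x v) (saturation k (P.output S l w D x v)) := by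
  have hX : P.X ∈ 𝓝 x := P.isOpen_X.mem_nhds hx
  rw [inner_gradient_left, (hasFDerivAt_shapedStorage hβ
    ((hS.1.contDiffAt hX).differentiableAt two_ne_zero)
    ((hγ.1.contDiffAt hX).differentiableAt two_ne_zero)).fderiv, _root_.add_apply,
    ContinuousLinearMap.comp_apply, hγ.2.1 x hx, ← inner_gradient_left, velocity, inner_add_right,
    hS.2 x hx, ← inner_transpose_toEuclideanLin, innerSL_apply_apply]
  set y := P.output S l w D x v with hy
  have hq : gradPotential α β (γ xs) (γ x) + P.kappa xs = -v - saturation k y := by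
    rw [controlLaw_eq hβ] at hv
    nth_rewrite 1 [hv]
    abel
  have hg : (P.g x)ᵀ.toEuclideanLin (gradient S x) = y - (2 : ℝ) • (w x)ᵀ.toEuclideanLin (l x)
      - ((w x)ᵀ * w x + D x).toEuclideanLin v := by
    rw [hy, output]
    abel
  rw [hq, hg, map_add, LinearMap.add_apply, inner_sub_left, inner_sub_left, inner_add_left,
    inner_skew hD, inner_toEuclideanLin_gram, real_inner_smul_left,
    inner_transpose_toEuclideanLin, inner_sub_left, inner_neg_left, norm_add_sq_real,
    real_inner_comm v y, real_inner_comm (saturation k y) y]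
  ring

theorem isLyapunovFunction_shapedStorage (hβ : ∀ i, 0 < β i) (hk : ∀ i, 0 < k i)
    (hS : P.IsStorage S l) (hγ : P.IsShaping S l w D xs α β γ)
    (hD : ∀ x ∈ P.X, D x = -(D x)ᵀ) (hx : xs ∈ P.X)
    (hu : ∀ x ∈ P.X, u x = P.controlLaw xs α β k γ x (P.output S l w D x (u x))) :
    IsLyapunovFunction P.X (P.closedLoop u) xs (P.shapedStorage S xs α β γ) := by
  have hX : P.X ∈ 𝓝 xs := P.isOpen_X.mem_nhds hx
  have hS2 := hS.1.contDiffAt hX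
  have hγ2 := hγ.1.contDiffAt hX
  have hdiff : ∀ᶠ x in 𝓝 xs, DifferentiableAt ℝ (P.shapedStorage S xs α β γ) x := by
    filter_upwards [hS2.eventually (by simp), hγ2.eventually (by simp)] with x h1 h2
    exact (hasFDerivAt_shapedStorage hβ (h1.differentiableAt two_ne_zero)
      (h2.differentiableAt two_ne_zero)).differentiableAt
  have hmin := eventually_lt_of_hasFDerivAt_gradient hdiff
    (gradient_shapedStorage_self hβ (hS2.differentiableAt two_ne_zero)
      (hγ2.differentiableAt two_ne_zero) hγ.2.2.1)
    (hasFDerivAt_gradient_shapedStorage hβ hS2 hγ2)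
    fun v hv => inner_pos_of_posDef hγ.2.2.2 hv
  obtain ⟨U, hU, hUo, hxU⟩ := _root_.eventually_nhds_iff.1 hmin
  refine ⟨P.X ∩ U, inter_subset_left, P.isOpen_X.inter hUo, ⟨hx, hxU⟩, ?_,
    fun x hxU => hU x hxU.2, fun x hxU => ?_⟩
  · have hpot : ContDiff ℝ 1 (potential α β (γ xs)) := by
      refine ContDiff.sum fun i _ => contDiff_const.mul (ContDiff.log ?_
        fun z => (Real.cosh_pos _).ne')
      have h : ContDiff ℝ 1 fun z : Vec m => z i :=
        (EuclideanSpace.proj i : Vec m →L[ℝ] ℝ).contDiff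
      exact Real.contDiff_cosh.comp (contDiff_const.mul (h.sub contDiff_const))
    have hγ1 : ContDiffOn ℝ 1 γ P.X := hγ.1.of_le (by norm_num)
    have hγi : ∀ i, ContDiffOn ℝ 1 (fun z => γ z i) P.X := fun i =>
      (EuclideanSpace.proj i : Vec m →L[ℝ] ℝ).contDiff.comp_contDiffOn hγ1
    refine ContDiffOn.mono ?_ inter_subset_left
    exact ((hS.1.of_le (by norm_num)).add (hpot.comp_contDiffOn hγ1)).add
      (ContDiffOn.sum fun i _ => contDiffOn_const.mul (hγi i))
  · have := inner_gradient_shapedStorage hβ hS hγ hxU.1 (hD x hxU.1) (hu x hxU.1)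
    rw [closedLoop, this]
    linarith [inner_saturation_nonneg hk (P.output S l w D x (u x)),
      sq_nonneg ‖l x + (w x).toEuclideanLin (u x)‖]

/-- The power balance vanishes only if `y = 0` and `ℓ + w u = 0`; the former turns the control law
into `u = -∇Φ - κ`. -/
theorem inner_gradient_shapedStorage_eq_zero (hβ : ∀ i, 0 < β i) (hk : ∀ i, 0 < k i)
    (hS : P.IsStorage S l) (hγ : P.IsShaping S l w D xs α β γ) (hx : x ∈ P.X)
    (hD : D x = -(D x)ᵀ) {v : Vec m}
    (hv : v = P.controlLaw xs α β k γ x (P.output S l w D x v))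
    (h0 : inner ℝ (gradient (P.shapedStorage S xs α β γ) x) (P.velocity x v) = 0) :
    l x = (w x).toEuclideanLin (gradient (potential α β (γ xs)) (γ x) + P.kappa xs) ∧
      P.output S l w D x v = 0 := by
  rw [inner_gradient_shapedStorage hβ hS hγ hx hD hv] at h0
  have hy : P.output S l w D x v = 0 := by
    by_contra hne
    nlinarith [inner_saturation_pos hk hne, sq_nonneg ‖l x + (w x).toEuclideanLin v‖]
  refine ⟨?_, hy⟩
  have hl : l x + (w x).toEuclideanLin v = 0 := by
    rw [hy, inner_zero_left, sub_zero, neg_eq_zero] at h0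
    simpa using h0
  have hsat : saturation k (0 : Vec m) = 0 := by
    ext i
    simp
  rw [hy, controlLaw_eq hβ, hsat, sub_zero] at hv
  rw [(hasGradientAt_potential (fun i => (hβ i).ne') _ _).gradient, eq_neg_of_add_eq_zero_left hl,
    ← map_neg, hv]
  congr 1
  abel

end Storage

end InputAffineSystem

end SaturatedPBC

theorem mainTheorem1 {n m r : ℕ} (P : SaturatedPBC.InputAffineSystem n m)
    -- the desired equilibrium is assignable
    (N : SaturatedPBC.Vec n → Matrix (Fin (n - m)) (Fin n) ℝ) (hN : P.IsLeftAnnihilator N)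
    (xs : SaturatedPBC.Vec n) (hxs : xs ∈ P.assignableEquilibria N)
    -- the storage function and the passive output
    (S : SaturatedPBC.Vec n → ℝ) (l : SaturatedPBC.Vec n → SaturatedPBC.Vec r)
    (hS : P.IsStorage S l)
    (w : SaturatedPBC.Vec n → Matrix (Fin r) (Fin m) ℝ)
    (D : SaturatedPBC.Vec n → Matrix (Fin m) (Fin m) ℝ) (hD : ∀ x ∈ P.X, D x = -(D x)ᵀ)
    -- the map `γ` and the constants
    (α β k : Fin m → ℝ) (hα : ∀ i, 0 < α i) (hβ : ∀ i, 0 < β i) (hk : ∀ i, 0 < k i)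
    (γ : SaturatedPBC.Vec n → SaturatedPBC.Vec m) (hγ : P.IsShaping S l w D xs α β γ) :
    -- the control law, an equation for `u` because `y` depends on `u`, defines a unique feedback
    (∀ x ∈ P.X, ∃! v : SaturatedPBC.Vec m,
      v = P.controlLaw xs α β k γ x (P.output S l w D x v)) ∧
    ∀ u : SaturatedPBC.Vec n → SaturatedPBC.Vec m,
      (∀ x ∈ P.X, u x = P.controlLaw xs α β k γ x (P.output S l w D x (u x))) →
      -- (i)
      (∀ x ∈ P.X, ∀ i, u x i ∈
        Set.Icc (-P.kappa xs i - k i - α i) (-P.kappa xs i + k i + α i)) ∧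
      -- (ii)
      (SaturatedPBC.IsStableEquilibrium P.X (P.closedLoop u) xs ∧
        SaturatedPBC.IsLyapunovFunction P.X (P.closedLoop u) xs
          (P.shapedStorage S xs α β γ)) ∧
      -- (iii)
      ((∃ Ω ⊆ P.X, IsOpen Ω ∧ xs ∈ Ω ∧ ∀ x ∈ Ω,
          l x = (w x).toEuclideanLin
            (gradient (SaturatedPBC.potential α β (γ xs)) (γ x) + P.kappa xs) →
          P.output S l w D x (u x) = 0 → x = xs) →
        SaturatedPBC.IsAsymptoticallyStableEquilibrium P.X (P.closedLoop u) xs) := by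
  have hx := hxs.1
  refine ⟨fun x hx => SaturatedPBC.InputAffineSystem.existsUnique_controlLaw hβ hk hγ hx (hD x hx),
    fun u hu => ⟨fun x hx i => ?_, ?_⟩⟩
  · rw [hu x hx]
    exact SaturatedPBC.InputAffineSystem.controlLaw_mem_Icc hα hβ hk x _ i
  have hlyap := SaturatedPBC.InputAffineSystem.isLyapunovFunction_shapedStorage hβ hk hS hγ hD hx hu
  have hlip := SaturatedPBC.InputAffineSystem.lipschitzNear_closedLoop hβ hk hγ hD hu hx
  have heq : P.closedLoop u xs = 0 := by
    rw [SaturatedPBC.InputAffineSystem.closedLoop,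
      SaturatedPBC.InputAffineSystem.feedback_eq_neg_kappa hN hxs hβ hk hγ (hD xs hx) (hu xs hx),
      SaturatedPBC.InputAffineSystem.velocity_neg_kappa hN hxs]
  refine ⟨⟨hlyap.isStableEquilibrium hlip heq, hlyap⟩, ?_⟩
  rintro ⟨Ω, hΩX, hΩ, hxΩ, hdet⟩
  refine hlyap.isAsymptoticallyStableEquilibrium hlip heq (hΩ.mem_nhds hxΩ) fun x hx hne h0 => ?_
  obtain ⟨h1, h2⟩ := SaturatedPBC.InputAffineSystem.inner_gradient_shapedStorage_eq_zero hβ hk hS hγ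
    (hΩX hx) (hD x (hΩX hx)) (hu x (hΩX hx)) h0
  exact hne (hdet x hx h1 h2)
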